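/- Let $n\ge 0$ be an integer, let $K=\mathbf{C}(x_{11},\dots,x_{n+1\,n+1},y_1,\dots,y_{n+1},r)$ be the field of rational functions in the $2n+3$ variables $x_{ii}$, $y_i$ ($1\le i\le n+1$) and $r$, and let $$R=K\langle\partial_{11},\dots,\partial_{n+1\,n+1},\partial_1,\dots,\partial_{n+1},\partial_r\rangle$$ be the ring of differential operators with coefficients in $K$, where $\partial_{ii}=\partial/\partial x_{ii}$, $\partial_i=\partial/\partial y_i$, $\partial_r=\partial/\partial r$. Put $a_{ij}=2(x_{ii}-x_{jj})$ and \begin{align*} A_i&=\partial_{ii}-\partial_i^2 && (1\le i\le n+1),\\ B&=\sum_{i=1}^{n+1}\partial_i^2-r^2,\\ C_{ij}&=a_{ij}\partial_i\partial_j+y_i\partial_j-y_j\partial_i && (1\le i<j\le n+1),\\ D_k&=\partial_kB-\sum_{l<k}\partial_l\,a_{lk}^{-1}\,C_{lk} && (1\le k\le n+1),\\ E&=r\partial_r-2\sum_{i=1}^{n+1}x_{ii}\partial_i^2-\sum_{i=1}^{n+1}y_i\partial_i-n. \end{align*} Let $R\tilde I$ be the left ideal of $R$ generated by all $A_i$,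 $B$, $C_{ij}$ and $E$. Let $<$ be the block term order $\partial_r\gg\{\partial_{ii}\}\gg\{\partial_j\}$, with the graded lexicographic order with $\partial_{11}>\cdots>\partial_{n+1\,n+1}$ inside the second block and the graded lexicographic order with $\partial_1>\cdots>\partial_{n+1}$ inside the third. Every $P\in R$ is uniquely a finite sum of terms $c\,\partial_r^{\gamma}\prod_i\partial_{ii}^{\alpha_i}\prod_k\partial_k^{\beta_k}$ with $c\in K$. For $P\ne 0$, if the term of $P$ with the $<$-largest monomial is $c\,\partial_r^{\gamma}\prod_i\partial_{ii}^{\alpha_i}\prod_k\partial_k^{\beta_k}$, then the initial monomial of $P$ is $\iota^{\gamma}\prod_i\xi_{ii}^{\alpha_i}\prod_k\eta_k^{\beta_k}$ and its initial term $\mathrm{in}_<(P)$ is $c$ times this monomial, both in the commutative polynomial ring $K[\xi_{11},\dots,\xi_{n+1\,n+1},\eta_1,\dots,\eta_{n+1},\iota]$. A Gröbner basis of a left ideal $J$ of $R$ is a finite generating set $G$ of $J$ such that the initial terms of the elements of $G$ generate the same ideal as the initial terms of all nonzero elements of $J$. Then the set of all $A_i$, $B$, $C_{ij}$ $(i<j)$,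 $D_k$ and $E$ is a Gröbner basis of $R\tilde I$ with respect to $<$. The initial monomials of $A_i$, $B$, $C_{ij}$, $D_k$, $E$ are $\xi_{ii}$, $\eta_1^2$, $\eta_i\eta_j$, $\eta_k^3$, $\iota$ respectively, and their initial terms are $\xi_{ii}$, $\eta_1^2$, $a_{ij}\eta_i\eta_j$, $\eta_k^3$, $r\iota$ respectively. -/

import Mathlib

open MvPolynomial

noncomputable section

/-! ## Rings of differential operators with rational function coefficients -/

namespace RatWeyl

/-- The field `ℂ(x_v : v ∈ σ)` of rational functions in the variables `σ`. -/
def RatField (σ : Type) : Type := FractionRing (MvPolynomial σ ℂ)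

instance (σ : Type) : Field (RatField σ) :=
  inferInstanceAs (Field (FractionRing (MvPolynomial σ ℂ)))

instance (σ : Type) : Algebra (MvPolynomial σ ℂ) (RatField σ) :=
  inferInstanceAs (Algebra (MvPolynomial σ ℂ) (FractionRing (MvPolynomial σ ℂ)))

instance (σ : Type) : Algebra ℂ (RatField σ) :=
  inferInstanceAs (Algebra ℂ (FractionRing (MvPolynomial σ ℂ)))

instance (σ : Type) : IsScalarTower ℂ (MvPolynomial σ ℂ) (RatField σ) :=
  inferInstanceAs (IsScalarTower ℂ (MvPolynomial σ ℂ) (FractionRing (MvPolynomial σ ℂ)))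

instance (σ : Type) : IsFractionRing (MvPolynomial σ ℂ) (RatField σ) :=
  inferInstanceAs (IsFractionRing (MvPolynomial σ ℂ) (FractionRing (MvPolynomial σ ℂ)))

/-- The variable `x_v`, as a rational function. -/
def var {σ : Type} (v : σ) : RatField σ := algebraMap (MvPolynomial σ ℂ) (RatField σ) (X v)

/-- The partial derivative `∂/∂x_v` on polynomials, with values in rational functions. -/
def polyDeriv {σ : Type} (v : σ) : Derivation ℂ (MvPolynomial σ ℂ) (RatField σ) :=
  mkDerivation ℂ (fun w => by classical exact if w = v then 1 else 0)

/-- The partial derivative `∂/∂x_v` on rational functions: the extension of `polyDeriv v`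
to the field of fractions. It is the only one, see `ratDeriv_unique`. -/
def ratDeriv {σ : Type} (v : σ) : Derivation ℂ (RatField σ) (RatField σ) :=
  haveI : Algebra.FormallyEtale (MvPolynomial σ ℂ) (RatField σ) :=
    Algebra.FormallyEtale.of_isLocalization (nonZeroDivisors (MvPolynomial σ ℂ))
  (((polyDeriv v).liftKaehlerDifferential.liftBaseChange (RatField σ)).comp
    (KaehlerDifferential.tensorKaehlerEquivOfFormallyEtale ℂ (MvPolynomial σ ℂ)
      (RatField σ)).symm.toLinearMap).compDer (KaehlerDifferential.D ℂ (RatField σ))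

theorem ratDeriv_algebraMap {σ : Type} (v : σ) (f : MvPolynomial σ ℂ) :
    ratDeriv v (algebraMap _ (RatField σ) f) = algebraMap _ (RatField σ) (pderiv v f) := by
  have : Algebra.FormallyEtale (MvPolynomial σ ℂ) (RatField σ) :=
    Algebra.FormallyEtale.of_isLocalization (nonZeroDivisors (MvPolynomial σ ℂ))
  have h1 : ratDeriv v (algebraMap _ (RatField σ) f) = polyDeriv v f := by
    simp [ratDeriv, KaehlerDifferential.tensorKaehlerEquivOfFormallyEtale_symm_D_algebraMap]
  have h2 : polyDeriv v =
      (Algebra.linearMap (MvPolynomial σ ℂ) (RatField σ)).compDer (pderiv v) := by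
    classical
    apply MvPolynomial.derivation_ext
    intro w
    by_cases h : w = v
    · subst h
      simp [polyDeriv, mkDerivation_X]
    · simp [polyDeriv, mkDerivation_X, h, pderiv_X_of_ne (Ne.symm (Ne.symm h))]
  rw [h1, h2]
  rfl

theorem derivation_eq_zero {σ : Type} (D : Derivation ℂ (RatField σ) (RatField σ))
    (h : ∀ f : MvPolynomial σ ℂ, D (algebraMap _ _ f) = 0) : D = 0 := by
  ext g
  obtain ⟨a, b, hb, rfl⟩ := IsFractionRing.div_surjective (A := MvPolynomial σ ℂ) g
  have hb0 : algebraMap (MvPolynomial σ ℂ) (RatField σ) b ≠ 0 :=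
    IsFractionRing.to_map_ne_zero_of_mem_nonZeroDivisors hb
  have := D.leibniz (algebraMap (MvPolynomial σ ℂ) (RatField σ) a /
    algebraMap (MvPolynomial σ ℂ) (RatField σ) b) (algebraMap _ _ b)
  rw [div_mul_cancel₀ _ hb0, h, h] at this
  simpa [hb0] using this.symm

theorem ratDeriv_unique {σ : Type} (v : σ) (D : Derivation ℂ (RatField σ) (RatField σ))
    (h : ∀ f : MvPolynomial σ ℂ, D (algebraMap _ _ f) = algebraMap _ _ (pderiv v f)) :
    D = ratDeriv v := by
  rw [← sub_eq_zero]
  refine derivation_eq_zero _ fun f => ?_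
  simp [h, ratDeriv_algebraMap]

theorem pderiv_comm {σ : Type} (v w : σ) (f : MvPolynomial σ ℂ) :
    pderiv v (pderiv w f) = pderiv w (pderiv v f) := by
  classical
  have h : ⁅(pderiv v : Derivation ℂ (MvPolynomial σ ℂ) (MvPolynomial σ ℂ)), pderiv w⁆ =
      (0 : Derivation ℂ (MvPolynomial σ ℂ) (MvPolynomial σ ℂ)) := by
    apply MvPolynomial.derivation_ext
    intro u
    rw [Derivation.commutator_apply]
    simp [pderiv_X, Pi.single_apply, apply_ite]
  have h' := DFunLike.congr_fun h f
  rw [Derivation.commutator_apply] at h'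
  exact sub_eq_zero.1 h'

theorem ratDeriv_comm {σ : Type} (v w : σ) (f : RatField σ) :
    ratDeriv v (ratDeriv w f) = ratDeriv w (ratDeriv v f) := by
  have h : ⁅ratDeriv v, ratDeriv w⁆ = (0 : Derivation ℂ (RatField σ) (RatField σ)) := by
    refine derivation_eq_zero _ fun f => ?_
    rw [Derivation.commutator_apply]
    simp only [ratDeriv_algebraMap]
    rw [pderiv_comm, sub_self]
  have h' := DFunLike.congr_fun h f
  rw [Derivation.commutator_apply] at h'
  exact sub_eq_zero.1 h'

/-- The ring `ℂ(x_v : v ∈ σ)⟨∂_v : v ∈ σ⟩` of differential operators with rational function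
coefficients: the algebra of operators on `ℂ(x)` generated by the multiplications by
rational functions and the partial derivatives. -/
def diffOps (σ : Type) : Subalgebra ℂ (Module.End ℂ (RatField σ)) :=
  Algebra.adjoin ℂ (Set.range (fun c : RatField σ => Algebra.lmul ℂ (RatField σ) c) ∪
    Set.range (fun v : σ => (ratDeriv v : RatField σ →ₗ[ℂ] RatField σ)))

/-- The ring `ℂ(x)⟨∂⟩`. -/
abbrev R (σ : Type) : Type := ↥(diffOps σ)

/-- A rational function, as a differential operator of order zero. -/
def fn {σ : Type} : RatField σ →ₐ[ℂ] R σ :=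
  (Algebra.lmul ℂ (RatField σ)).codRestrict (diffOps σ)
    (fun c => Algebra.subset_adjoin (Or.inl ⟨c, rfl⟩))

/-- The operator `∂_v`. -/
def del {σ : Type} (v : σ) : R σ :=
  ⟨(ratDeriv v : RatField σ →ₗ[ℂ] RatField σ), Algebra.subset_adjoin (Or.inr ⟨v, rfl⟩)⟩

theorem fn_apply {σ : Type} (c f : RatField σ) :
    (fn c : Module.End ℂ (RatField σ)) f = c * f := rfl

theorem del_apply {σ : Type} (v : σ) (f : RatField σ) :
    (del v : Module.End ℂ (RatField σ)) f = ratDeriv v f := rfl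

theorem del_commute {σ : Type} (v w : σ) : Commute (del v) (del w) := by
  apply Subtype.ext
  ext f
  exact ratDeriv_comm v w f

theorem del_mul_fn {σ : Type} (v : σ) (c : RatField σ) :
    del v * fn c = fn c * del v + fn (ratDeriv v c) := by
  apply Subtype.ext
  apply LinearMap.ext
  intro f
  change ratDeriv v (c * f) = c * ratDeriv v f + ratDeriv v c * f
  rw [Derivation.leibniz, smul_eq_mul, smul_eq_mul, mul_comm f]

theorem del_pow_pairwise {σ : Type} [Fintype σ] (α : σ →₀ ℕ) :
    ((Finset.univ : Finset σ) : Set σ).Pairwise (Function.onFun Commute fun v => del v ^ α v) :=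
  fun v _ w _ _ => (del_commute v w).pow_pow (α v) (α w)

/-- The monomial `∂^α = ∏_v ∂_v ^ α_v`. -/
def delPow {σ : Type} [Fintype σ] (α : σ →₀ ℕ) : R σ :=
  Finset.univ.noncommProd (fun v => del v ^ α v)
    (del_pow_pairwise α)

theorem delPow_zero {σ : Type} [Fintype σ] : delPow (0 : σ →₀ ℕ) = 1 := by
  unfold delPow
  rw [Finset.noncommProd_eq_pow_card _ _ _ 1 (by simp)]
  simp

theorem delPow_add {σ : Type} [Fintype σ] (α β : σ →₀ ℕ) :
    delPow (α + β) = delPow α * delPow β := by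
  unfold delPow
  rw [← Finset.noncommProd_mul_distrib]
  · exact Finset.noncommProd_congr rfl (fun v _ => by simp [pow_add]) _
  · exact fun v _ w _ _ => (del_commute _ _).pow_pow _ _

theorem delPow_single {σ : Type} [Fintype σ] (v : σ) : delPow (Finsupp.single v 1) = del v := by
  classical
  unfold delPow
  rw [← Finset.noncommProd_erase_mul Finset.univ (Finset.mem_univ v) _ (del_pow_pairwise _)
    ((del_pow_pairwise _).mono (Finset.coe_subset.2 (Finset.subset_univ _))),
    Finset.noncommProd_eq_pow_card _ _ _ 1]
  · simp
  · intro w hw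
    simp [(Finset.ne_of_mem_erase hw).symm]

/-- The operator `∑_α c_α ∂^α` (coefficients on the left) of a polynomial `∑_α c_α ξ^α` in
commuting variables `ξ_v` over `ℂ(x)`. -/
def ofSymbol {σ : Type} [Fintype σ] : MvPolynomial σ (RatField σ) →+ R σ where
  toFun p := ∑ α ∈ p.support, fn (p.coeff α) * delPow α
  map_zero' := by simp
  map_add' p q := by
    classical
    have h : ∀ (p : MvPolynomial σ (RatField σ)) (s : Finset (σ →₀ ℕ)), p.support ⊆ s →
        ∑ α ∈ p.support, fn (p.coeff α) * delPow α = ∑ α ∈ s, fn (p.coeff α) * delPow α := by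
      intro p s hs
      refine Finset.sum_subset hs fun α _ hα => ?_
      rw [notMem_support_iff.1 hα, map_zero, zero_mul]
    rw [h (p + q) (p.support ∪ q.support) support_add,
      h p (p.support ∪ q.support) Finset.subset_union_left,
      h q (p.support ∪ q.support) Finset.subset_union_right, ← Finset.sum_add_distrib]
    refine Finset.sum_congr rfl fun α _ => ?_
    rw [coeff_add, map_add, add_mul]

theorem ofSymbol_eq_sum {σ : Type} [Fintype σ] (p : MvPolynomial σ (RatField σ)) :
    ofSymbol p = ∑ α ∈ p.support, fn (p.coeff α) * delPow α := rfl

theorem ofSymbol_monomial {σ : Type} [Fintype σ] (α : σ →₀ ℕ) (c : RatField σ) :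
    ofSymbol (monomial α c) = fn c * delPow α := by
  classical
  rw [ofSymbol_eq_sum, support_monomial]
  split_ifs with h
  · simp [h]
  · simp

theorem delPow_apply_monomial {σ : Type} [Fintype σ] (α : σ →₀ ℕ) : ∀ β : σ →₀ ℕ, ∀ b : ℂ,
    ∃ c : ℂ, (delPow α : Module.End ℂ (RatField σ)) (algebraMap _ _ (monomial β b)) =
      algebraMap (MvPolynomial σ ℂ) (RatField σ) (monomial (β - α) c) ∧
      (c ≠ 0 ↔ b ≠ 0 ∧ α ≤ β) := by
  have hadd : ∀ α₁ α₂ : σ →₀ ℕ,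
      (∀ β : σ →₀ ℕ, ∀ b : ℂ, ∃ c : ℂ, (delPow α₁ : Module.End ℂ (RatField σ))
        (algebraMap _ _ (monomial β b)) =
          algebraMap (MvPolynomial σ ℂ) (RatField σ) (monomial (β - α₁) c) ∧
          (c ≠ 0 ↔ b ≠ 0 ∧ α₁ ≤ β)) →
      (∀ β : σ →₀ ℕ, ∀ b : ℂ, ∃ c : ℂ, (delPow α₂ : Module.End ℂ (RatField σ))
        (algebraMap _ _ (monomial β b)) =
          algebraMap (MvPolynomial σ ℂ) (RatField σ) (monomial (β - α₂) c) ∧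
          (c ≠ 0 ↔ b ≠ 0 ∧ α₂ ≤ β)) →
      (∀ β : σ →₀ ℕ, ∀ b : ℂ, ∃ c : ℂ, (delPow (α₁ + α₂) : Module.End ℂ (RatField σ))
        (algebraMap _ _ (monomial β b)) =
          algebraMap (MvPolynomial σ ℂ) (RatField σ) (monomial (β - (α₁ + α₂)) c) ∧
          (c ≠ 0 ↔ b ≠ 0 ∧ α₁ + α₂ ≤ β)) := by
    intro α₁ α₂ h1 h2 β b
    obtain ⟨c, hc, hc'⟩ := h2 β b
    obtain ⟨d, hd, hd'⟩ := h1 (β - α₂) c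
    refine ⟨d, ?_, ?_⟩
    · rw [delPow_add]
      change (delPow α₁ : Module.End ℂ (RatField σ)) ((delPow α₂ : Module.End ℂ (RatField σ)) _) = _
      rw [hc, hd, tsub_tsub, add_comm α₂]
    · rw [hd', hc', and_assoc]
      refine and_congr_right fun _ => ⟨fun ⟨h, h'⟩ => ?_, fun h => ⟨?_, ?_⟩⟩
      · exact (le_tsub_iff_right h).1 h'
      · exact le_trans le_add_self h
      · exact le_tsub_of_add_le_right h
  have hzero : ∀ β : σ →₀ ℕ, ∀ b : ℂ, ∃ c : ℂ, ((delPow 0 : R σ) : Module.End ℂ (RatField σ))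
        (algebraMap _ _ (monomial β b)) =
          algebraMap (MvPolynomial σ ℂ) (RatField σ) (monomial (β - 0) c) ∧
          (c ≠ 0 ↔ b ≠ 0 ∧ 0 ≤ β) := by
    intro β b
    exact ⟨b, by rw [delPow_zero, tsub_zero]; rfl, by simp⟩
  induction α using Finsupp.induction_linear with
  | zero => exact hzero
  | add f g hf hg => exact hadd f g hf hg
  | single v k =>
    induction k with
    | zero => simpa using hzero
    | succ k ih =>
      rw [Finsupp.single_add]
      refine hadd _ _ ih fun β b => ⟨b * β v, ?_, ?_⟩
      · rw [delPow_single, del_apply, ratDeriv_algebraMap, pderiv_monomial]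
      · simp [Finsupp.single_le_iff, Nat.one_le_iff_ne_zero]

theorem ofSymbol_injective {σ : Type} [Fintype σ] : Function.Injective (ofSymbol (σ := σ)) := by
  rw [injective_iff_map_eq_zero]
  intro p hp
  by_contra hne
  obtain ⟨α, hα, hmin⟩ := Finset.exists_min_image p.support (fun α => α.degree)
    (support_nonempty.2 hne)
  have h0 : ((ofSymbol p : R σ) : Module.End ℂ (RatField σ))
      (algebraMap _ _ (monomial α (1 : ℂ))) = 0 := by rw [hp]; rfl
  rw [ofSymbol_eq_sum, AddSubmonoidClass.coe_finsetSum, LinearMap.sum_apply,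
    Finset.sum_eq_single α] at h0
  · obtain ⟨c, hc, hc'⟩ := delPow_apply_monomial α α 1
    change p.coeff α * _ = 0 at h0
    rw [hc] at h0
    rcases mul_eq_zero.1 h0 with h | h
    · exact (mem_support_iff.1 hα) h
    · have hc0 : c ≠ 0 := hc'.2 ⟨one_ne_zero, le_rfl⟩
      rw [FaithfulSMul.algebraMap_eq_zero_iff, monomial_eq_zero] at h
      exact hc0 h
  · intro β hβ hβα
    obtain ⟨c, hc, hc'⟩ := delPow_apply_monomial β α 1
    have : c = 0 := by
      by_contra h
      have hle := (hc'.1 h).2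
      have hadd : β + (α - β) = α := add_tsub_cancel_of_le hle
      have hd := hmin β hβ
      have hdeg := congrArg Finsupp.degree hadd
      rw [map_add] at hdeg
      have h0 : (α - β).degree = 0 := by omega
      rw [Finsupp.degree_eq_zero_iff] at h0
      rw [h0, add_zero] at hadd
      exact hβα hadd
    change p.coeff β * _ = 0
    rw [hc, this]
    simp
  · intro h
    exact absurd hα h

theorem ofSymbol_surjective {σ : Type} [Fintype σ] : Function.Surjective (ofSymbol (σ := σ)) := by
  have key : ∀ P : Module.End ℂ (RatField σ), ∀ hP : P ∈ diffOps σ,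
      ∀ q : MvPolynomial σ (RatField σ), ∃ p, ofSymbol p = (⟨P, hP⟩ : R σ) * ofSymbol q := by
    have hfn : ∀ c : RatField σ, ∀ q : MvPolynomial σ (RatField σ),
        ∃ p, ofSymbol p = fn c * ofSymbol q := by
      intro c q
      induction q using MvPolynomial.induction_on' with
      | monomial α a =>
        exact ⟨monomial α (c * a), by
          rw [ofSymbol_monomial, ofSymbol_monomial, map_mul, mul_assoc]⟩
      | add q₁ q₂ h₁ h₂ =>
        obtain ⟨p₁, hp₁⟩ := h₁
        obtain ⟨p₂, hp₂⟩ := h₂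
        exact ⟨p₁ + p₂, by rw [map_add, map_add, mul_add, hp₁, hp₂]⟩
    intro P hP
    induction hP using Algebra.adjoin_induction with
    | mem P hP =>
      rcases hP with ⟨c, rfl⟩ | ⟨v, rfl⟩
      · exact hfn c
      · intro q
        change ∃ p, ofSymbol p = del v * ofSymbol q
        have hmon : ∀ α a, del v * ofSymbol (monomial α a) =
            ofSymbol (monomial (Finsupp.single v 1 + α) a + monomial α (ratDeriv v a)) := by
          intro α a
          rw [map_add, ofSymbol_monomial, ofSymbol_monomial, ofSymbol_monomial, ← mul_assoc,
            del_mul_fn, add_mul, delPow_add, delPow_single, mul_assoc]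
        induction q using MvPolynomial.induction_on' with
        | monomial α a => exact ⟨_, (hmon α a).symm⟩
        | add q₁ q₂ h₁ h₂ =>
          obtain ⟨p₁, hp₁⟩ := h₁
          obtain ⟨p₂, hp₂⟩ := h₂
          exact ⟨p₁ + p₂, by rw [map_add, map_add, mul_add, hp₁, hp₂]⟩
    | algebraMap r =>
        intro q
        obtain ⟨p, hp⟩ := hfn (algebraMap ℂ _ r) q
        refine ⟨p, hp.trans ?_⟩
        rw [AlgHom.commutes]
        rfl
    | add P Q hP hQ ihP ihQ =>
      intro q
      obtain ⟨p₁, h₁⟩ := ihP q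
      obtain ⟨p₂, h₂⟩ := ihQ q
      exact ⟨p₁ + p₂, by rw [map_add, h₁, h₂, ← add_mul]; rfl⟩
    | mul P Q hP hQ ihP ihQ =>
      intro q
      obtain ⟨p₁, h₁⟩ := ihQ q
      obtain ⟨p₂, h₂⟩ := ihP p₁
      exact ⟨p₂, by rw [h₂, h₁, ← mul_assoc]; rfl⟩
  intro P
  obtain ⟨p, hp⟩ := key P.1 P.2 1
  refine ⟨p, hp.trans ?_⟩
  rw [← C_1, ← monomial_zero', ofSymbol_monomial, delPow_zero, map_one, mul_one, mul_one]

/-- The symbol `∑_α c_α ξ^α` of an operator `P = ∑_α c_α ∂^α`: every element of `ℂ(x)⟨∂⟩` has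
exactly one such normal form. -/
def symbol {σ : Type} [Fintype σ] : R σ ≃+ MvPolynomial σ (RatField σ) :=
  (AddEquiv.ofBijective (ofSymbol (σ := σ)) ⟨ofSymbol_injective, ofSymbol_surjective⟩).symm

/-- The initial term `c_α ξ^α` of an operator, an element of the polynomial ring `ℂ(x)[ξ]`:
the term of the normal form with the largest `ξ^α`. -/
def initTerm {σ : Type} [Fintype σ] (m : MonomialOrder σ) (P : R σ) :
    MvPolynomial σ (RatField σ) :=
  m.leadingTerm (symbol P)

/-- The initial monomial `ξ^α` of a (nonzero) operator, without its coefficient. -/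
def initMonomial {σ : Type} [Fintype σ] (m : MonomialOrder σ) (P : R σ) :
    MvPolynomial σ (RatField σ) :=
  monomial (m.degree (symbol P)) 1

/-- `G` is a Gröbner basis of the left ideal `J` of `ℂ(x)⟨∂⟩` for the term order `m`: it is a finite
generating set of `J`, and the initial terms of its elements generate the ideal of `ℂ(x)[ξ]`
spanned by the initial terms of all elements of `J`. (For a noncommutative ring, `Ideal` means
left ideal.) -/
structure IsGroebnerBasis {σ : Type} [Fintype σ] (m : MonomialOrder σ) (J : Ideal (R σ))
    (G : Set (R σ)) : Prop where
  finite : G.Finite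
  span_eq : Ideal.span G = J
  span_initTerm_eq : Ideal.span (initTerm m '' G) = Ideal.span (initTerm m '' {P | P ∈ J ∧ P ≠ 0})

end RatWeyl

/-- The block order on the monomials in two blocks of variables, the first block being larger:
compare the exponents in the first block by `m₁`, and break ties by `m₂` on the second block. -/
def MonomialOrder.block {σ τ : Type} (m₁ : MonomialOrder σ) (m₂ : MonomialOrder τ) :
    MonomialOrder (σ ⊕ τ) where
  syn := m₁.syn ×ₗ m₂.syn
  addCommMonoidSyn := inferInstanceAs (AddCommMonoid (Lex (m₁.syn × m₂.syn)))
  linearOrderSyn := Prod.Lex.instLinearOrder _ _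
  isOrderedAddMonoid_syn := Prod.Lex.isOrderedAddMonoid
  toSyn :=
    { toFun := fun α => toLex (m₁.toSyn (Finsupp.sumFinsuppAddEquivProdFinsupp α).1,
        m₂.toSyn (Finsupp.sumFinsuppAddEquivProdFinsupp α).2)
      invFun := fun s => Finsupp.sumFinsuppAddEquivProdFinsupp.symm
        (m₁.toSyn.symm (ofLex s).1, m₂.toSyn.symm (ofLex s).2)
      left_inv := fun α => by simp
      right_inv := fun s => by simp
      map_add' := fun α β => by simp only [map_add, Prod.fst_add, Prod.snd_add]; rfl }
  toSyn_monotone := by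
    intro α β h
    change toLex _ ≤ toLex _
    exact Prod.Lex.toLex_mono ⟨m₁.toSyn_monotone fun v => h (Sum.inl v),
      m₂.toSyn_monotone fun v => h (Sum.inr v)⟩
  wellFoundedLT_syn := inferInstanceAs (WellFoundedLT (m₁.syn ×ₗ m₂.syn))

theorem MonomialOrder.block_lt_iff {σ τ : Type} (m₁ : MonomialOrder σ) (m₂ : MonomialOrder τ)
    (α β : σ ⊕ τ →₀ ℕ) :
    (m₁.block m₂).toSyn α < (m₁.block m₂).toSyn β ↔
      m₁.toSyn (Finsupp.sumFinsuppAddEquivProdFinsupp α).1 <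
          m₁.toSyn (Finsupp.sumFinsuppAddEquivProdFinsupp β).1 ∨
        m₁.toSyn (Finsupp.sumFinsuppAddEquivProdFinsupp α).1 =
            m₁.toSyn (Finsupp.sumFinsuppAddEquivProdFinsupp β).1 ∧
          m₂.toSyn (Finsupp.sumFinsuppAddEquivProdFinsupp α).2 <
            m₂.toSyn (Finsupp.sumFinsuppAddEquivProdFinsupp β).2 :=
  Prod.Lex.toLex_lt_toLex

/-! ## The diagonal Fisher–Bingham system -/

namespace FisherBingham

open RatWeyl

/-- The variables `r`, `x_{ii}`, `y_i` (in this order), `i` running over `n + 1` indices. -/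
abbrev Var (n : ℕ) : Type := Unit ⊕ (Fin (n + 1) ⊕ Fin (n + 1))

/-- The index of the variable `r`. -/
abbrev rIdx (n : ℕ) : Var n := Sum.inl ()

/-- The index of the variable `x_{ii}`. -/
abbrev xIdx {n : ℕ} (i : Fin (n + 1)) : Var n := Sum.inr (Sum.inl i)

/-- The index of the variable `y_i`. -/
abbrev yIdx {n : ℕ} (i : Fin (n + 1)) : Var n := Sum.inr (Sum.inr i)

/-- The rational function `r`. -/
def r (n : ℕ) : RatField (Var n) := var (rIdx n)

/-- The rational function `x_{ii}`. -/
def x {n : ℕ} (i : Fin (n + 1)) : RatField (Var n) := var (xIdx i)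

/-- The rational function `y_i`. -/
def y {n : ℕ} (i : Fin (n + 1)) : RatField (Var n) := var (yIdx i)

/-- The rational function `a_{ij} = 2 (x_{ii} - x_{jj})`. -/
def a {n : ℕ} (i j : Fin (n + 1)) : RatField (Var n) := 2 * (x i - x j)

/-- `∂_r = ∂/∂r`. -/
def dr (n : ℕ) : R (Var n) := del (rIdx n)

/-- `∂_{ii} = ∂/∂x_{ii}`. -/
def dx {n : ℕ} (i : Fin (n + 1)) : R (Var n) := del (xIdx i)

/-- `∂_i = ∂/∂y_i`. -/
def dy {n : ℕ} (i : Fin (n + 1)) : R (Var n) := del (yIdx i)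

/-- `A_i = ∂_{ii} - ∂_i²`. -/
def A {n : ℕ} (i : Fin (n + 1)) : R (Var n) := dx i - dy i ^ 2

/-- `B = ∑_i ∂_i² - r²`. -/
def B (n : ℕ) : R (Var n) := ∑ i, dy i ^ 2 - fn (r n ^ 2)

/-- `C_{ij} = 2 (x_{ii} - x_{jj}) ∂_i ∂_j + y_i ∂_j - y_j ∂_i`. -/
def C {n : ℕ} (i j : Fin (n + 1)) : R (Var n) :=
  fn (a i j) * dy i * dy j + fn (y i) * dy j - fn (y j) * dy i

/-- `D_k = ∂_k B - ∑_{l < k} ∂_l a_{lk}⁻¹ C_{lk}`. -/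
def D {n : ℕ} (k : Fin (n + 1)) : R (Var n) :=
  dy k * B n - ∑ l ∈ Finset.Iio k, dy l * fn (a l k)⁻¹ * C l k

/-- `E = r ∂_r - 2 ∑_i x_{ii} ∂_i² - ∑_i y_i ∂_i - n`. -/
def E (n : ℕ) : R (Var n) :=
  fn (r n) * dr n - 2 * ∑ i, fn (x i) * dy i ^ 2 - ∑ i, fn (y i) * dy i - (n : R (Var n))

/-- The left ideal of `ℂ(x, y, r)⟨∂⟩` generated by all `A_i`, `B`, `C_{ij}` (`i < j`) and `E`. -/
def diagIdeal (n : ℕ) : Ideal (R (Var n)) :=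
  Ideal.span (Set.range A ∪ {B n} ∪ {P | ∃ i j : Fin (n + 1), i < j ∧ P = C i j} ∪ {E n})

/-- The set of all `A_i`, `B`, `C_{ij}` (`i < j`), `D_k` and `E`. -/
def basis (n : ℕ) : Set (R (Var n)) :=
  Set.range A ∪ {B n} ∪ {P | ∃ i j : Fin (n + 1), i < j ∧ P = C i j} ∪ Set.range D ∪ {E n}

/-- The block order `∂_r ≫ {∂_{ii}} ≫ {∂_j}` with the graded lexicographic order in each block,
where `∂_{11} > ⋯ > ∂_{n+1,n+1}` and `∂_1 > ⋯ > ∂_{n+1}`. -/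
def order (n : ℕ) : MonomialOrder (Var n) :=
  MonomialOrder.degLex.block (MonomialOrder.degLex.block MonomialOrder.degLex)

/-- The commuting variable `ι` corresponding to `∂_r`. -/
def ι (n : ℕ) : MvPolynomial (Var n) (RatField (Var n)) := X (rIdx n)

/-- The commuting variable `ξ_{ii}` corresponding to `∂_{ii}`. -/
def ξ {n : ℕ} (i : Fin (n + 1)) : MvPolynomial (Var n) (RatField (Var n)) := X (xIdx i)

/-- The commuting variable `η_i` corresponding to `∂_i`. -/
def η {n : ℕ} (i : Fin (n + 1)) : MvPolynomial (Var n) (RatField (Var n)) := X (yIdx i)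

end FisherBingham

end

/-!
The generators annihilate the Fisher–Bingham integral, which up to a constant is an inverse
Laplace transform in `r²`: it equals `∫ r e^{r² s} Φ ds` over a suitable cycle in the plane of one
new variable `s`, where `Φ = ∏_i (s - x_{ii})^{-1/2} e^{y_i² / (4 (s - x_{ii}))}`. Every operator
`P` acts under the integral sign, so it has an integrand: the rational function `g` of `s` with
`P (r e^{r² s} Φ) = g e^{r² s} Φ` (`integrand`, built from the existence and uniqueness of normal
forms in `exists_intertwining`). The integrands of `A_i` and `C_{ij}` vanish, those of `B` and `E`
are total derivatives with respect to `s`, and total derivatives are stable under the action of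
all operators; so the integrand of every element of the ideal is a total derivative `∇ f`
(`integrand_mem_exactForms`), where `f` has poles at the points `x_{ii}` only.

The initial terms of the basis are read off from the normal forms. The monomials that they
do not divide are `1`, `η_k` and, for `k ≠ 1`, `η_k²`, and it remains to exclude them as initial
monomials of elements `P` of the ideal (`degree_symbol_ne_of_mem_diagIdeal`). Since the order is a
block order, such a `P` involves only monomials of degree at most two in the `∂_i`, not including
`∂_1²`. Its integrand has at most double poles at the `x_{ii}`, at most a simple pole at `x_{11}`,
and is bounded at infinity. But `∇` raises the order of a pole at `x_{ii}` by two, because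
`y_i ≠ 0`, even if this order is zero, and preserves the degree at infinity, because `r ≠ 0`. So
`f` is a constant that vanishes at `x_{11}` (`eq_zero_of_mem_exactForms`), and the integrand of
`P` is zero. This contradicts the contribution of the initial monomial, which for `η_k` and `η_k²`
is the largest pole at `x_{kk}` (`exists_numerator`). No S-pairs have to be reduced.
-/

noncomputable section

/-! ### Extension of the ground field -/

namespace RatWeyl

/-- The embedding `ℂ(x_v : v ∈ σ) → ℂ(x_w : w ∈ τ)` along an injective renaming of variables. -/
def renameField {σ τ : Type} (f : σ → τ) (hf : Function.Injective f) :
    RatField σ →+* RatField τ :=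
  IsFractionRing.lift (A := MvPolynomial σ ℂ)
    (g := (algebraMap (MvPolynomial τ ℂ) (RatField τ)).comp (rename f).toRingHom)
    ((FaithfulSMul.algebraMap_injective _ _).comp (rename_injective f hf))

theorem renameField_algebraMap {σ τ : Type} (f : σ → τ) (hf : Function.Injective f)
    (p : MvPolynomial σ ℂ) :
    renameField f hf (algebraMap _ _ p) = algebraMap _ (RatField τ) (rename f p) :=
  IsFractionRing.lift_algebraMap _ _

theorem ratDeriv_renameField {σ τ : Type} (f : σ → τ) (hf : Function.Injective f) (v : σ)
    (c : RatField σ) :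
    ratDeriv (f v) (renameField f hf c) = renameField f hf (ratDeriv v c) := by
  obtain ⟨a, b, -, rfl⟩ := IsFractionRing.div_surjective (A := MvPolynomial σ ℂ) c
  simp only [map_div₀, Derivation.leibniz_div, renameField_algebraMap, ratDeriv_algebraMap,
    pderiv_rename hf, smul_eq_mul, map_mul, map_sub, map_pow, map_inv₀]

theorem ratDeriv_renameField_of_notMem {σ τ : Type} (f : σ → τ) (hf : Function.Injective f) {u : τ}
    (hu : u ∉ Set.range f) (c : RatField σ) : ratDeriv u (renameField f hf c) = 0 := by
  classical
  obtain ⟨a, b, -, rfl⟩ := IsFractionRing.div_surjective (A := MvPolynomial σ ℂ) c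
  have h : ∀ p : MvPolynomial σ ℂ, pderiv u (rename f p) = 0 := fun p => by
    refine pderiv_eq_zero_of_notMem_vars fun h => hu ?_
    obtain ⟨v, -, hv⟩ := Finset.mem_image.1 (vars_rename f p h)
    exact ⟨v, hv⟩
  simp only [map_div₀, Derivation.leibniz_div, renameField_algebraMap, ratDeriv_algebraMap, h,
    map_zero, smul_zero, sub_zero]

theorem ratDeriv_var_self {σ : Type} (v : σ) : ratDeriv v (var v) = 1 := by
  simp [var, ratDeriv_algebraMap]

theorem ratDeriv_var_of_ne {σ : Type} {v w : σ} (h : w ≠ v) : ratDeriv v (var w) = 0 := by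
  simp [var, ratDeriv_algebraMap, pderiv_X_of_ne h]

/-! ### Twisted actions of the ring of differential operators -/

theorem symbol_fn_mul_delPow {σ : Type} [Fintype σ] (c : RatField σ) (α : σ →₀ ℕ) :
    symbol (fn c * delPow α) = monomial α c := by
  rw [← ofSymbol_monomial]
  exact AddEquiv.symm_apply_apply _ _

theorem ofSymbol_symbol {σ : Type} [Fintype σ] (P : R σ) : ofSymbol (symbol P) = P :=
  AddEquiv.apply_symm_apply (AddEquiv.ofBijective (ofSymbol (σ := σ)) _) _

theorem induction_on_normalForm {σ : Type} [Fintype σ] {p : R σ → Prop} (P : R σ)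
    (monomial : ∀ c α, p (fn c * delPow α)) (add : ∀ P Q, p P → p Q → p (P + Q)) : p P := by
  rw [← ofSymbol_symbol P]
  induction symbol P using MvPolynomial.induction_on' with
  | monomial α c => rw [ofSymbol_monomial]; exact monomial c α
  | add q q' h h' => rw [map_add]; exact add _ _ h h'

/-- Powers of a commuting family, indexed by multi-exponents. -/
theorem exists_multiPow {σ M : Type} [Fintype σ] [Monoid M] (T : σ → M)
    (hT : ∀ v w, Commute (T v) (T w)) :
    ∃ U : (σ →₀ ℕ) → M, U 0 = 1 ∧ ∀ v α, U (Finsupp.single v 1 + α) = T v * U α := by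
  classical
  have hcomm : Pairwise fun v w => ∀ a b : Multiplicative ℕ,
      Commute (powersHom M (T v) a) (powersHom M (T w) b) := fun v w _ a b => by
    simpa using (hT v w).pow_pow _ _
  refine ⟨fun α => MonoidHom.noncommPiCoprod (fun v => powersHom M (T v)) hcomm
    fun v => Multiplicative.ofAdd (α v), map_one _, fun v α => ?_⟩
  have h : T v = MonoidHom.noncommPiCoprod (fun v => powersHom M (T v)) hcomm
      (Pi.mulSingle v (Multiplicative.ofAdd 1)) := by
    rw [MonoidHom.noncommPiCoprod_mulSingle]
    simp
  dsimp only
  conv_rhs => rw [h]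
  rw [← map_mul]
  congr 1

/-- Commuting operators that satisfy the Leibniz rule over the coefficient field make any vector
`f` the image of `1` under a linear map that intertwines `∂_v` with `T v`: normal forms exist and
are unique, and commuting with the coefficients is the only relation besides commutativity. -/
theorem exists_intertwining {σ : Type} [Fintype σ] {L : Type} [CommRing L] [Algebra ℂ L]
    (e : RatField σ →+* L) (T : σ → Module.End ℂ L) (hT : ∀ v w, Commute (T v) (T w))
    (hLeib : ∀ v c g, T v (e c * g) = e c * T v g + e (ratDeriv v c) * g) (f : L) :
    ∃ ψ : R σ →+ L, ψ 1 = f ∧ (∀ c P, ψ (fn c * P) = e c * ψ P) ∧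
      ∀ v P, ψ (del v * P) = T v (ψ P) := by
  classical
  obtain ⟨U, hU0, hU⟩ := exists_multiPow T hT
  let := e.toAlgebra
  have hsmul : ∀ c g, c • g = e c * g := fun c g => Algebra.smul_def c g
  let ψ : R σ →+ L :=
    ((basisMonomials σ (RatField σ)).constr ℕ fun α => U α f).toAddMonoidHom.comp
      (symbol (σ := σ)).toAddMonoidHom
  have hψ : ∀ c α, ψ (fn c * delPow α) = e c * U α f := by
    intro c α
    change (basisMonomials σ (RatField σ)).constr ℕ (fun α => U α f) (symbol (fn c * delPow α)) = _
    have h := (basisMonomials σ (RatField σ)).constr_basis ℕ (fun α => U α f) α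
    rw [coe_basisMonomials] at h
    rw [symbol_fn_mul_delPow, show monomial α c = c • monomial α (1 : RatField σ) by
      rw [smul_monomial, smul_eq_mul, mul_one], map_smul, hsmul, h]
  refine ⟨ψ, ?_, ?_, ?_⟩
  · have := hψ 1 0
    rwa [map_one fn, delPow_zero, mul_one, map_one e, hU0, one_mul] at this
  · intro c P
    induction P using induction_on_normalForm with
    | monomial b α => rw [← mul_assoc, ← map_mul, hψ, hψ, map_mul, mul_assoc]
    | add P Q hP hQ => rw [mul_add, map_add, map_add, hP, hQ, mul_add]
  · intro v P
    induction P using induction_on_normalForm with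
    | monomial b α =>
      rw [← mul_assoc, del_mul_fn, add_mul, mul_assoc, ← delPow_single, ← delPow_add, map_add, hψ,
        hψ, hψ, hLeib, hU]
      rfl
    | add P Q hP hQ => rw [mul_add, map_add, map_add, hP, hQ, map_add]

/-- A predicate that is stable under coefficients and derivatives is stable under all operators. -/
theorem mul_induction {σ : Type} {p : R σ → Prop} (hadd : ∀ P Q, p P → p Q → p (P + Q))
    (hfn : ∀ c P, p P → p (fn c * P)) (hdel : ∀ v P, p P → p (del v * P)) (P : R σ) {Q : R σ}
    (hQ : p Q) : p (P * Q) := by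
  obtain ⟨P, hP⟩ := P
  induction hP using Algebra.adjoin_induction generalizing Q with
  | mem P hP =>
    rcases hP with ⟨c, rfl⟩ | ⟨v, rfl⟩
    · exact hfn c Q hQ
    · exact hdel v Q hQ
  | algebraMap c =>
    have := hfn (algebraMap ℂ _ c) Q hQ
    rw [AlgHom.commutes] at this
    exact this
  | add P P' hP hP' ih ih' =>
    have := hadd _ _ (ih hQ) (ih' hQ)
    rw [← add_mul] at this
    exact this
  | mul P P' hP hP' ih ih' =>
    have := ih (ih' hQ)
    rw [← mul_assoc] at this
    exact this

/-- The operators on `ℂ(x)` obtained from the `∂_v` on conjugating by `exp(G) ∏_i (ℓ i)^{-1/2}`: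
they are the twisted derivatives `∂_v + ∂_v G - 1/2 ∑_i ∂_v (ℓ i) / ℓ i`. -/
def twistedDeriv {σ ι : Type} [Fintype ι] (G : RatField σ) (ℓ : ι → RatField σ) (v : σ) :
    Module.End ℂ (RatField σ) :=
  (ratDeriv v : RatField σ →ₗ[ℂ] RatField σ) +
    Algebra.lmul ℂ (RatField σ) (ratDeriv v G - 2⁻¹ * ∑ i, ratDeriv v (ℓ i) / ℓ i)

theorem twistedDeriv_apply {σ ι : Type} [Fintype ι] (G : RatField σ) (ℓ : ι → RatField σ) (v : σ)
    (f : RatField σ) : twistedDeriv G ℓ v f =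
      ratDeriv v f + (ratDeriv v G - 2⁻¹ * ∑ i, ratDeriv v (ℓ i) / ℓ i) * f := rfl

theorem twistedDeriv_commute {σ ι : Type} [Fintype ι] (G : RatField σ) (ℓ : ι → RatField σ)
    (v w : σ) : Commute (twistedDeriv G ℓ v) (twistedDeriv G ℓ w) := by
  have h2 : ∀ u : σ, ratDeriv u (2⁻¹ : RatField σ) = 0 := fun u => by
    rw [Derivation.leibniz_inv, show (2 : RatField σ) = ((2 : ℕ) : RatField σ) from rfl,
      Derivation.map_natCast, smul_zero]
  -- the coefficients of the twist are logarithmic derivatives, hence closed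
  have hclosed : ratDeriv v (ratDeriv w G - 2⁻¹ * ∑ i, ratDeriv w (ℓ i) / ℓ i) =
      ratDeriv w (ratDeriv v G - 2⁻¹ * ∑ i, ratDeriv v (ℓ i) / ℓ i) := by
    simp only [map_sub, Derivation.leibniz, h2, map_sum, Derivation.leibniz_div, smul_eq_mul,
      mul_zero, add_zero]
    rw [ratDeriv_comm v w G]
    congr 2
    refine Finset.sum_congr rfl fun i _ => ?_
    rw [ratDeriv_comm v w (ℓ i)]
    ring
  apply LinearMap.ext
  intro f
  simp only [Module.End.mul_apply, twistedDeriv_apply]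
  rw [map_add, map_add, Derivation.leibniz, Derivation.leibniz, hclosed, ratDeriv_comm v w f]
  simp only [smul_eq_mul]
  ring

theorem twistedDeriv_mul {σ ι : Type} [Fintype ι] (G : RatField σ) (ℓ : ι → RatField σ) (v : σ)
    (c f : RatField σ) :
    twistedDeriv G ℓ v (c * f) = c * twistedDeriv G ℓ v f + ratDeriv v c * f := by
  simp only [twistedDeriv_apply, Derivation.leibniz, smul_eq_mul]
  ring

end RatWeyl

/-! ### Initial terms -/

namespace RatWeyl

open scoped MonomialOrder

/-- `mul_sub`, for the subtraction that elaboration finds on the elements of the subalgebra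
`diffOps σ`. -/
theorem operator_mul_sub {σ : Type} (P Q S : R σ) : P * (Q - S) = P * Q - P * S := mul_sub P Q S

/-- `sub_zero`, for the subtraction that elaboration finds on the elements of the subalgebra
`diffOps σ`. -/
theorem operator_sub_zero {σ : Type} (P : R σ) : P - 0 = P := sub_zero P

/-- The operators all of whose monomials are smaller than `ξ^α`. -/
def below {σ : Type} [Fintype σ] (m : MonomialOrder σ) (α : σ →₀ ℕ) : AddSubgroup (R σ) where
  carrier := {P | ∀ β ∈ (symbol P).support, β ≺[m] α}
  zero_mem' := by simp
  add_mem' {P Q} hP hQ β hβ := by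
    classical
    rw [map_add] at hβ
    exact (Finset.mem_union.1 (support_add hβ)).elim (hP β) (hQ β)
  neg_mem' {P} hP β hβ := by
    rw [map_neg, support_neg] at hβ
    exact hP β hβ

theorem fn_mul_delPow_mem_below {σ : Type} [Fintype σ] {m : MonomialOrder σ} {α β : σ →₀ ℕ}
    (h : β ≺[m] α) (c : RatField σ) : fn c * delPow β ∈ below m α := by
  intro γ hγ
  rw [symbol_fn_mul_delPow] at hγ
  rwa [Finset.mem_singleton.1 (support_monomial_subset hγ)]

theorem fn_mul_mem_below {σ : Type} [Fintype σ] {m : MonomialOrder σ} {α : σ →₀ ℕ}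
    (c : RatField σ) {P : R σ} (hP : P ∈ below m α) : fn c * P ∈ below m α := by
  rw [← ofSymbol_symbol P, ofSymbol_eq_sum, Finset.mul_sum]
  refine sum_mem fun β hβ => ?_
  rw [← mul_assoc, ← map_mul]
  exact fn_mul_delPow_mem_below (hP β hβ) _

theorem degree_symbol_eq {σ : Type} [Fintype σ] {m : MonomialOrder σ} {α : σ →₀ ℕ}
    {c : RatField σ} (hc : c ≠ 0) {P : R σ} (hP : P - fn c * delPow α ∈ below m α) :
    m.degree (symbol P) = α ∧ (symbol P).coeff α = c := by
  classical
  obtain ⟨Q, rfl⟩ : ∃ Q, P = fn c * delPow α + Q := ⟨P - fn c * delPow α, by abel⟩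
  have hQ : fn c * delPow α + Q - fn c * delPow α = Q := by abel
  rw [hQ] at hP
  rw [map_add, symbol_fn_mul_delPow]
  have hα : (symbol Q).coeff α = 0 := by
    by_contra h
    exact lt_irrefl _ (hP α (mem_support_iff.2 h))
  have hcoeff : (monomial α c + symbol Q).coeff α = c := by
    rw [coeff_add, coeff_monomial, if_pos rfl, hα, add_zero]
  refine ⟨?_, hcoeff⟩
  apply m.toSyn.injective
  apply le_antisymm
  · refine m.degree_le_iff.2 fun β hβ => ?_
    rcases Finset.mem_union.1 (support_add hβ) with h | h
    · rw [Finset.mem_singleton.1 (support_monomial_subset h)]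
    · exact (hP β h).le
  · exact m.le_degree (mem_support_iff.2 (by rwa [hcoeff]))

theorem initMonomial_eq {σ : Type} [Fintype σ] {m : MonomialOrder σ} {α : σ →₀ ℕ}
    {c : RatField σ} (hc : c ≠ 0) {P : R σ} (hP : P - fn c * delPow α ∈ below m α) :
    initMonomial m P = monomial α 1 := by
  rw [initMonomial, (degree_symbol_eq hc hP).1]

theorem initTerm_eq {σ : Type} [Fintype σ] {m : MonomialOrder σ} {α : σ →₀ ℕ}
    {c : RatField σ} (hc : c ≠ 0) {P : R σ} (hP : P - fn c * delPow α ∈ below m α) :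
    initTerm m P = monomial α c := by
  obtain ⟨h1, h2⟩ := degree_symbol_eq hc hP
  rw [initTerm, MonomialOrder.leadingTerm, MonomialOrder.leadingCoeff, h1, h2]

end RatWeyl

namespace FisherBingham

open RatWeyl
open scoped MonomialOrder

/-! ### The block order -/

/-- The exponent vector of a monomial in the variables `η_i` only. -/
def yExp {n : ℕ} : (Fin (n + 1) →₀ ℕ) →+ (Var n →₀ ℕ) :=
  Finsupp.mapDomain.addMonoidHom fun i => yIdx i

theorem yExp_single {n : ℕ} (i : Fin (n + 1)) (k : ℕ) :
    yExp (Finsupp.single i k) = Finsupp.single (yIdx i) k :=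
  Finsupp.mapDomain_single

theorem yExp_injective {n : ℕ} : Function.Injective (yExp (n := n)) :=
  Finsupp.mapDomain_injective fun i j h => by simpa using h

theorem yExp_eq_symm {n : ℕ} (γ : Fin (n + 1) →₀ ℕ) :
    yExp γ = Finsupp.sumFinsuppAddEquivProdFinsupp.symm
      (0, Finsupp.sumFinsuppAddEquivProdFinsupp.symm (0, γ)) := by
  induction γ using Finsupp.induction_linear with
  | zero =>
    rw [map_zero, ← Prod.zero_eq_mk, map_zero, ← Prod.zero_eq_mk, map_zero]
  | add f g hf hg =>
    rw [map_add, hf, hg, ← map_add, Prod.mk_add_mk, ← map_add, Prod.mk_add_mk, add_zero, add_zero]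
  | single i k =>
    classical
    rw [yExp_single]
    ext v
    rcases v with v | v | v <;> simp [Finsupp.sumFinsuppAddEquivProdFinsupp, Finsupp.single_apply]

theorem lt_yExp_iff {n : ℕ} (α : Var n →₀ ℕ) (γ : Fin (n + 1) →₀ ℕ) :
    α ≺[order n] yExp γ ↔ ∃ β, α = yExp β ∧ β ≺[MonomialOrder.degLex] γ := by
  constructor
  · intro h
    obtain ⟨⟨u, w⟩, rfl⟩ := Finsupp.sumFinsuppAddEquivProdFinsupp.symm.surjective α
    obtain ⟨⟨v, β⟩, rfl⟩ := Finsupp.sumFinsuppAddEquivProdFinsupp.symm.surjective w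
    have hzero : ∀ {τ : Type} (m : MonomialOrder τ) (a : τ →₀ ℕ), ¬ m.toSyn a < m.toSyn 0 :=
      fun m a h => not_lt_of_ge (m.toSyn_monotone (zero_le (a := a))) h
    rw [yExp_eq_symm, order, MonomialOrder.block_lt_iff, MonomialOrder.block_lt_iff] at h
    simp only [AddEquiv.apply_symm_apply] at h
    rcases h with h | ⟨h, h' | ⟨h', h''⟩⟩
    · exact (hzero _ _ h).elim
    · exact (hzero _ _ h').elim
    · refine ⟨β, ?_, h''⟩
      rw [yExp_eq_symm, MonomialOrder.degLex.toSyn.injective h,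
        MonomialOrder.degLex.toSyn.injective h']
  · rintro ⟨β, rfl, h⟩
    rw [yExp_eq_symm, yExp_eq_symm, order, MonomialOrder.block_lt_iff, MonomialOrder.block_lt_iff]
    simp only [AddEquiv.apply_symm_apply, true_and]
    exact Or.inr (Or.inr h)

theorem yExp_lt_single_xIdx {n : ℕ} (γ : Fin (n + 1) →₀ ℕ) (i : Fin (n + 1)) :
    yExp γ ≺[order n] Finsupp.single (xIdx i) 1 := by
  refine lt_of_not_ge fun h => ?_
  rcases h.eq_or_lt with h | h
  · have := DFunLike.congr_fun ((order n).toSyn.injective h) (xIdx i)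
    rw [Finsupp.single_eq_same, yExp, Finsupp.mapDomain.addMonoidHom_apply,
      Finsupp.mapDomain_of_notMem_range _ _ (by simp)] at this
    exact one_ne_zero this
  · obtain ⟨β, hβ, -⟩ := (lt_yExp_iff _ _).1 h
    have := DFunLike.congr_fun hβ (xIdx i)
    rw [Finsupp.single_eq_same, yExp, Finsupp.mapDomain.addMonoidHom_apply,
      Finsupp.mapDomain_of_notMem_range _ _ (by simp)] at this
    exact one_ne_zero this

theorem yExp_lt_single_rIdx {n : ℕ} (γ : Fin (n + 1) →₀ ℕ) :
    yExp γ ≺[order n] Finsupp.single (rIdx n) 1 := by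
  refine lt_of_not_ge fun h => ?_
  rcases h.eq_or_lt with h | h
  · have := DFunLike.congr_fun ((order n).toSyn.injective h) (rIdx n)
    rw [Finsupp.single_eq_same, yExp, Finsupp.mapDomain.addMonoidHom_apply,
      Finsupp.mapDomain_of_notMem_range _ _ (by simp)] at this
    exact one_ne_zero this
  · obtain ⟨β, hβ, -⟩ := (lt_yExp_iff _ _).1 h
    have := DFunLike.congr_fun hβ (rIdx n)
    rw [Finsupp.single_eq_same, yExp, Finsupp.mapDomain.addMonoidHom_apply,
      Finsupp.mapDomain_of_notMem_range _ _ (by simp)] at this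
    exact one_ne_zero this

theorem degLex_lt_of_degree_lt {n : ℕ} {β γ : Fin (n + 1) →₀ ℕ} (h : β.degree < γ.degree) :
    β ≺[MonomialOrder.degLex] γ := by
  rw [MonomialOrder.degLex_lt_iff, Finsupp.DegLex.lt_iff]
  exact Or.inl h

theorem degree_le_of_degLex_le {n : ℕ} {β γ : Fin (n + 1) →₀ ℕ}
    (h : β ≼[MonomialOrder.degLex] γ) : β.degree ≤ γ.degree :=
  le_of_not_gt fun h' => not_lt_of_ge h (degLex_lt_of_degree_lt h')

theorem degLex_single_two_lt {n : ℕ} {i k : Fin (n + 1)} (h : k < i) :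
    Finsupp.single i 2 ≺[MonomialOrder.degLex] Finsupp.single k 2 := by
  have h1 := MonomialOrder.degLex_single_lt_iff.2 h
  have := add_lt_add h1 h1
  rwa [← map_add, ← map_add, ← Finsupp.single_add, ← Finsupp.single_add] at this

theorem fn_mul_delPow_yExp_mem_below {n : ℕ} {β γ : Fin (n + 1) →₀ ℕ}
    (h : β ≺[MonomialOrder.degLex] γ) (c : RatField (Var n)) :
    fn c * delPow (yExp β) ∈ below (order n) (yExp γ) :=
  fn_mul_delPow_mem_below ((lt_yExp_iff _ _).2 ⟨β, rfl, h⟩) c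

theorem delPow_yExp_mem_below {n : ℕ} {β γ : Fin (n + 1) →₀ ℕ}
    (h : β ≺[MonomialOrder.degLex] γ) :
    delPow (yExp β) ∈ below (order n) (yExp γ) := by
  simpa using fn_mul_delPow_yExp_mem_below h 1

theorem delPow_yExp_single_add {n : ℕ} (i : Fin (n + 1)) (β : Fin (n + 1) →₀ ℕ) :
    delPow (yExp (Finsupp.single i 1 + β)) = dy i * delPow (yExp β) := by
  rw [map_add, delPow_add, yExp_single, delPow_single]
  rfl

theorem delPow_yExp_single_one {n : ℕ} (i : Fin (n + 1)) :
    delPow (yExp (Finsupp.single i 1)) = dy i := by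
  rw [yExp_single, delPow_single]
  rfl

theorem delPow_yExp_single {n : ℕ} (i : Fin (n + 1)) (k : ℕ) :
    delPow (yExp (Finsupp.single i k)) = dy i ^ k := by
  induction k with
  | zero => rw [Finsupp.single_zero, map_zero, delPow_zero, pow_zero]
  | succ k ih => rw [add_comm k 1, Finsupp.single_add, delPow_yExp_single_add, ih, pow_add, pow_one]

theorem delPow_yExp_single_add_single {n : ℕ} (i j : Fin (n + 1)) (k l : ℕ) :
    delPow (yExp (Finsupp.single i k + Finsupp.single j l)) = dy i ^ k * dy j ^ l := by
  rw [map_add, delPow_add, delPow_yExp_single, delPow_yExp_single]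

/-! ### The initial terms of the elements of the basis -/

instance (σ : Type) : CharZero (RatField σ) :=
  charZero_of_injective_algebraMap (algebraMap ℂ (RatField σ)).injective

theorem var_injective {σ : Type} : Function.Injective (var (σ := σ)) := fun _ _ h =>
  X_injective (FaithfulSMul.algebraMap_injective (MvPolynomial σ ℂ) (RatField σ) h)

theorem var_ne_zero {σ : Type} (v : σ) : var v ≠ 0 := by
  rw [var, Ne, FaithfulSMul.algebraMap_eq_zero_iff]
  exact X_ne_zero v

theorem a_ne_zero {n : ℕ} {i j : Fin (n + 1)} (h : i ≠ j) : a i j ≠ 0 := by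
  refine mul_ne_zero two_ne_zero (sub_ne_zero.2 fun h' => h ?_)
  simpa using var_injective h'

theorem A_sub_mem_below {n : ℕ} (i : Fin (n + 1)) :
    A i - fn 1 * delPow (Finsupp.single (xIdx i) 1) ∈
      below (order n) (Finsupp.single (xIdx i) 1) := by
  have : A i - fn 1 * delPow (Finsupp.single (xIdx i) 1) =
      -(fn 1 * delPow (yExp (Finsupp.single i 2))) := by
    rw [map_one, one_mul, one_mul, delPow_single, delPow_yExp_single, A, dx]
    abel
  rw [this]
  exact neg_mem (fn_mul_delPow_mem_below (yExp_lt_single_xIdx _ _) _)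

theorem B_sub_mem_below (n : ℕ) :
    B n - fn 1 * delPow (yExp (Finsupp.single 0 2)) ∈
      below (order n) (yExp (Finsupp.single 0 2)) := by
  have : B n - fn 1 * delPow (yExp (Finsupp.single 0 2)) =
      ∑ i ∈ Finset.univ.erase (0 : Fin (n + 1)), delPow (yExp (Finsupp.single i 2)) -
        fn (r n ^ 2) * delPow (yExp 0) := by
    simp only [delPow_yExp_single]
    rw [map_one, one_mul, map_zero, delPow_zero, mul_one, B,
      ← Finset.add_sum_erase _ _ (Finset.mem_univ (0 : Fin (n + 1)))]
    abel
  rw [this]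
  refine sub_mem (sum_mem fun i hi => delPow_yExp_mem_below (degLex_single_two_lt ?_))
    (fn_mul_delPow_yExp_mem_below (degLex_lt_of_degree_lt (by simp)) _)
  exact Fin.pos_iff_ne_zero.2 (Finset.ne_of_mem_erase hi)

theorem C_sub_mem_below {n : ℕ} (i j : Fin (n + 1)) :
    C i j - fn (a i j) * delPow (yExp (Finsupp.single i 1 + Finsupp.single j 1)) ∈
      below (order n) (yExp (Finsupp.single i 1 + Finsupp.single j 1)) := by
  have : C i j - fn (a i j) * delPow (yExp (Finsupp.single i 1 + Finsupp.single j 1)) =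
      fn (y i) * delPow (yExp (Finsupp.single j 1)) -
        fn (y j) * delPow (yExp (Finsupp.single i 1)) := by
    rw [delPow_yExp_single_add, delPow_yExp_single_one, delPow_yExp_single_one, C, mul_assoc]
    abel
  rw [this]
  exact sub_mem (fn_mul_delPow_yExp_mem_below (degLex_lt_of_degree_lt (by simp)) _)
    (fn_mul_delPow_yExp_mem_below (degLex_lt_of_degree_lt (by simp)) _)

theorem E_sub_mem_below (n : ℕ) :
    E n - fn (r n) * delPow (Finsupp.single (rIdx n) 1) ∈
      below (order n) (Finsupp.single (rIdx n) 1) := by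
  have : E n - fn (r n) * delPow (Finsupp.single (rIdx n) 1) =
      -(fn 2 * ∑ i, fn (x i) * delPow (yExp (Finsupp.single i 2)) +
        ∑ i, fn (y i) * delPow (yExp (Finsupp.single i 1)) + fn n * delPow (yExp 0)) := by
    simp only [delPow_yExp_single, pow_one]
    rw [map_natCast, map_ofNat, map_zero, delPow_zero, mul_one, delPow_single, E, dr]
    abel
  rw [this]
  have h : ∀ (c : RatField (Var n)) γ,
      fn c * delPow (yExp γ) ∈ below (order n) (Finsupp.single (rIdx n) 1) :=
    fun c γ => fn_mul_delPow_mem_below (yExp_lt_single_rIdx γ) c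
  exact neg_mem (add_mem (add_mem (fn_mul_mem_below _ (sum_mem fun i _ => h _ _))
    (sum_mem fun i _ => h _ _)) (h _ _))

/-- The third order parts `∂_l² ∂_k`, `l < k`, of `∂_k B` are cancelled by the multiples of the
`C_{lk}`. -/
theorem del_mul_C {n : ℕ} {l k : Fin (n + 1)} (h : l ≠ k) :
    ∃ c c' d d' : RatField (Var n), dy l * fn (a l k)⁻¹ * C l k =
      dy k * dy l ^ 2 + fn c * (dy l * dy k) + fn c' * dy k - fn d * dy l ^ 2 - fn d' * dy l := by
  have hC : fn (a l k)⁻¹ * C l k =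
      dy l * dy k + fn ((a l k)⁻¹ * y l) * dy k - fn ((a l k)⁻¹ * y k) * dy l := by
    rw [C, operator_mul_sub, mul_add, mul_assoc (fn (a l k)),
      ← mul_assoc (fn (a l k)⁻¹) (fn (a l k)), ← mul_assoc (fn (a l k)⁻¹) (fn (y l)),
      ← mul_assoc (fn (a l k)⁻¹) (fn (y k)), ← map_mul, ← map_mul, ← map_mul,
      inv_mul_cancel₀ (a_ne_zero h), map_one, one_mul]
  have hd : ∀ c, dy l * fn c = fn c * dy l + fn (ratDeriv (yIdx l) c) := del_mul_fn _
  have hcomm : dy l * dy k = dy k * dy l := del_commute _ _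
  have h3 : dy l * (dy l * dy k) = dy k * dy l ^ 2 := by
    rw [hcomm, ← mul_assoc, hcomm, mul_assoc, pow_two]
  refine ⟨(a l k)⁻¹ * y l, ratDeriv (yIdx l) ((a l k)⁻¹ * y l), (a l k)⁻¹ * y k,
    ratDeriv (yIdx l) ((a l k)⁻¹ * y k), ?_⟩
  rw [mul_assoc, hC, operator_mul_sub, mul_add, h3, ← mul_assoc, ← mul_assoc, hd, hd, add_mul,
    add_mul, mul_assoc, mul_assoc (fn ((a l k)⁻¹ * y k)), ← pow_two]
  abel

theorem D_sub_mem_below {n : ℕ} (k : Fin (n + 1)) :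
    D k - fn 1 * delPow (yExp (Finsupp.single k 3)) ∈
      below (order n) (yExp (Finsupp.single k 3)) := by
  set H := below (order n) (yExp (Finsupp.single k 3)) with hH
  have h0 : ∀ c, fn c ∈ H := fun c => by
    simpa [delPow_zero] using fn_mul_delPow_yExp_mem_below (γ := Finsupp.single k 3) (β := 0)
      (degLex_lt_of_degree_lt (by simp)) c
  have h1 : ∀ c i, fn c * dy i ∈ H := fun c i => by
    rw [← delPow_yExp_single_one]
    exact fn_mul_delPow_yExp_mem_below (degLex_lt_of_degree_lt (by simp)) c
  have h2 : ∀ c i j, fn c * (dy i * dy j) ∈ H := fun c i j => by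
    rw [← delPow_yExp_single_one j, ← delPow_yExp_single_add]
    exact fn_mul_delPow_yExp_mem_below (degLex_lt_of_degree_lt (by simp)) c
  have h3 : ∀ i, k < i → dy k * dy i ^ 2 ∈ H := fun i hi => by
    rw [← delPow_yExp_single, ← delPow_yExp_single_add]
    refine delPow_yExp_mem_below ?_
    have := add_lt_add_right (degLex_single_two_lt hi)
      (MonomialOrder.degLex.toSyn (Finsupp.single k 1))
    rwa [← map_add, ← map_add, ← Finsupp.single_add] at this
  have hr : dy k * fn (r n ^ 2) ∈ H := by
    rw [dy, del_mul_fn]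
    exact add_mem (h1 _ _) (h0 _)
  have hsum : D k - fn 1 * delPow (yExp (Finsupp.single k 3)) =
      ∑ i, (dy k * dy i ^ 2 - (if i < k then dy i * fn (a i k)⁻¹ * C i k else 0) -
        (if i = k then dy i ^ 3 else 0)) - dy k * fn (r n ^ 2) := by
    have hs : ∀ f g : Fin (n + 1) → R (Var n), ∑ i, (f i - g i) = ∑ i, f i - ∑ i, g i :=
      fun f g => Finset.sum_sub_distrib f g
    rw [hs, hs, ← Finset.sum_filter, ← Finset.sum_filter,
      Finset.filter_gt_eq_Iio, Finset.filter_eq' _ k, if_pos (Finset.mem_univ k),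
      Finset.sum_singleton, D, B, operator_mul_sub, Finset.mul_sum, map_one, one_mul,
      delPow_yExp_single]
    abel
  rw [hsum]
  refine sub_mem (sum_mem fun i _ => ?_) hr
  rcases lt_trichotomy i k with h | rfl | h
  · rw [if_pos h, if_neg h.ne, operator_sub_zero]
    obtain ⟨c, c', d, d', hC⟩ := del_mul_C h.ne
    have : dy k * dy i ^ 2 - dy i * fn (a i k)⁻¹ * C i k =
        fn d * (dy i * dy i) + fn d' * dy i - fn c * (dy i * dy k) - fn c' * dy k := by
      rw [hC, ← pow_two]
      abel
    rw [this]
    exact sub_mem (sub_mem (add_mem (h2 _ _ _) (h1 _ _)) (h2 _ _ _)) (h1 _ _)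
  · rw [if_neg (lt_irrefl _), if_pos rfl, operator_sub_zero, pow_succ' _ 2]
    exact (sub_self (dy i * dy i ^ 2)).symm ▸ zero_mem H
  · rw [if_neg h.not_gt, if_neg h.ne', operator_sub_zero, operator_sub_zero]
    exact h3 i h

theorem monomial_yExp_single {n : ℕ} (i : Fin (n + 1)) (k : ℕ) :
    (monomial (yExp (Finsupp.single i k)) 1 : MvPolynomial (Var n) (RatField (Var n))) =
      η i ^ k := by
  rw [yExp_single, η, X_pow_eq_monomial]

theorem monomial_yExp_add {n : ℕ} (i j : Fin (n + 1)) (c : RatField (Var n)) :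
    monomial (yExp (Finsupp.single i 1 + Finsupp.single j 1)) c =
      MvPolynomial.C c * η i * η j := by
  rw [map_add, yExp_single, yExp_single, η, η, X, X, C_mul_monomial, monomial_mul, mul_one,
    mul_one]

end FisherBingham

/-! ### A twisted derivative on rational functions of one variable -/

section TwistedPolynomial

open Polynomial Lagrange

/-- With `w = ∏_i (s - x_i)`, the polynomial
`w² (r² - ∑_i (y_i² / (4 (s - x_i)²) + 1 / (2 (s - x_i))))`. -/
def potential {K ι : Type} [Field K] [Fintype ι] [DecidableEq ι]
    (x y : ι → K) (r : K) : K[X] :=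
  Polynomial.C (r ^ 2) * nodal Finset.univ x ^ 2 - ∑ i,
    (Polynomial.C (y i ^ 2 / 4) * nodal (Finset.univ.erase i) x ^ 2 +
    Polynomial.C (2⁻¹) * nodal Finset.univ x * nodal (Finset.univ.erase i) x)

theorem eval_nodal_erase_self_ne_zero {K ι : Type} [Field K] [Fintype ι] [DecidableEq ι]
    {x : ι → K} (hx : Function.Injective x) (i : ι) :
    (nodal (Finset.univ.erase i) x).eval (x i) ≠ 0 :=
  eval_nodal_not_at_node fun _ hj h => Finset.ne_of_mem_erase hj (hx h).symm

theorem eval_nodal_erase_of_ne {K ι : Type} [Field K] [Fintype ι] [DecidableEq ι]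
    (x : ι → K) {i j : ι} (h : j ≠ i) :
    (nodal (Finset.univ.erase i) x).eval (x j) = 0 :=
  eval_nodal_at_node (Finset.mem_erase.2 ⟨h, Finset.mem_univ j⟩)

theorem eval_nodal_univ {K ι : Type} [Field K] [Fintype ι]
    (x : ι → K) (i : ι) : (nodal Finset.univ x).eval (x i) = 0 :=
  eval_nodal_at_node (Finset.mem_univ i)

theorem eval_potential_ne_zero {K ι : Type} [Field K] [CharZero K] [Fintype ι]
    [DecidableEq ι] {x y : ι → K} (hx : Function.Injective x) {i : ι} (hy : y i ≠ 0)
    (r : K) : (potential x y r).eval (x i) ≠ 0 := by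
  have h : (potential x y r).eval (x i) =
      -(y i ^ 2 / 4 * (nodal (Finset.univ.erase i) x).eval (x i) ^ 2) := by
    simp only [potential, Polynomial.eval_sub, Polynomial.eval_mul, Polynomial.eval_pow,
      Polynomial.eval_C, Polynomial.eval_finsetSum, Polynomial.eval_add,
      eval_nodal_univ]
    rw [Finset.sum_eq_single i]
    · ring
    · intro j _ hj
      rw [eval_nodal_erase_of_ne x hj.symm]
      ring
    · simp
  rw [h]
  exact neg_ne_zero.2 (mul_ne_zero (div_ne_zero (pow_ne_zero 2 hy) (by norm_num))
    (pow_ne_zero 2 (eval_nodal_erase_self_ne_zero hx i)))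

theorem isCoprime_nodal_potential {K ι : Type} [Field K] [CharZero K] [Fintype ι]
    [DecidableEq ι] {x y : ι → K} (hx : Function.Injective x) (hy : ∀ i, y i ≠ 0)
    (r : K) : IsCoprime (nodal Finset.univ x) (potential x y r) := by
  refine IsCoprime.prod_left fun i _ => ?_
  rw [(irreducible_X_sub_C (x i)).coprime_iff_not_dvd, dvd_iff_isRoot]
  exact eval_potential_ne_zero hx (hy i) r

theorem natDegree_nodal_univ {K ι : Type} [Field K] [Fintype ι]
    (x : ι → K) : (nodal Finset.univ x).natDegree = Fintype.card ι :=
  natDegree_nodal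

theorem natDegree_nodal_erase_add_one {K ι : Type} [Field K] [Fintype ι] [DecidableEq ι]
    (x : ι → K) (i : ι) :
    (nodal (Finset.univ.erase i) x).natDegree + 1 = Fintype.card ι := by
  rw [natDegree_nodal, Finset.card_erase_add_one (Finset.mem_univ i), Finset.card_univ]

theorem natDegree_potential {K ι : Type} [Field K] [Fintype ι] [DecidableEq ι]
    [Nonempty ι] (x y : ι → K) {r : K} (hr : r ≠ 0) :
    (potential x y r).natDegree = 2 * Fintype.card ι := by
  have h1 : (Polynomial.C (r ^ 2) * nodal Finset.univ x ^ 2).natDegree = 2 * Fintype.card ι := by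
    rw [natDegree_C_mul (pow_ne_zero 2 hr), natDegree_pow, natDegree_nodal_univ]
  have hpos : 0 < Fintype.card ι := Fintype.card_pos
  rw [potential, natDegree_sub_eq_left_of_natDegree_lt, h1]
  rw [h1]
  refine lt_of_le_of_lt (natDegree_sum_le_of_forall_le (n := 2 * Fintype.card ι - 1) _ _
    fun i _ => ?_) (by omega)
  have hi := natDegree_nodal_erase_add_one x i
  have hu := natDegree_nodal_univ x
  refine natDegree_add_le_of_degree_le ?_ ?_
  · refine (natDegree_C_mul_le _ _).trans (natDegree_pow_le.trans ?_)
    omega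
  · rw [mul_assoc]
    refine (natDegree_C_mul_le _ _).trans (natDegree_mul_le.trans ?_)
    omega

/-- Let `w = ∏_i (s - x_i)` and let `∇ = d/ds + potential / w²`. If `V / w² = ∇ (p / w ^ m)` then,
comparing poles, `p / w ^ m` is a polynomial, and comparing degrees, it is constant;
as the pole of `V / w²` at one of the `x_i` is not of the full order two, it vanishes. -/
theorem eq_zero_of_eq_twisted_derivative {K ι : Type} [Field K] [CharZero K] [Fintype ι]
    [DecidableEq ι] {x y : ι → K} (hx : Function.Injective x)
    (hy : ∀ i, y i ≠ 0) {r : K} (hr : r ≠ 0) {V : K[X]} (hV : V.natDegree ≤ 2 * Fintype.card ι)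
    {i : ι} (hVi : V.eval (x i) = 0) (m : ℕ) (p : K[X])
    (h : V * nodal Finset.univ x ^ m = nodal Finset.univ x ^ 2 * derivative p -
      (m : K[X]) * nodal Finset.univ x * derivative (nodal Finset.univ x) * p +
        potential x y r * p) : V = 0 := by
  have : Nonempty ι := ⟨i⟩
  have hw : nodal Finset.univ x ≠ 0 := nodal_monic.ne_zero
  induction m generalizing p with
  | succ m ih =>
    have hdvd : nodal Finset.univ x ∣ potential x y r * p :=
      ⟨V * nodal Finset.univ x ^ m - nodal Finset.univ x * derivative p +
        ((m + 1 : ℕ) : K[X]) * derivative (nodal Finset.univ x) * p, by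
          linear_combination -h⟩
    obtain ⟨q, rfl⟩ := (isCoprime_nodal_potential hx hy r).dvd_of_dvd_mul_left hdvd
    refine ih q (mul_left_cancel₀ hw ?_)
    rw [derivative_mul] at h
    push_cast at h
    linear_combination h
  | zero =>
    rw [pow_zero, mul_one, Nat.cast_zero, zero_mul, zero_mul, zero_mul, sub_zero] at h
    have hp : p.natDegree = 0 := by
      by_contra hp
      have hp0 : p ≠ 0 := fun h0 => hp (by rw [h0, natDegree_zero])
      have hu0 : potential x y r ≠ 0 := fun h0 =>
        eval_potential_ne_zero hx (hy i) r (by rw [h0, Polynomial.eval_zero])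
      have h2 : (potential x y r * p).natDegree = 2 * Fintype.card ι + p.natDegree := by
        rw [natDegree_mul hu0 hp0, natDegree_potential x y hr]
      have h1 : (nodal Finset.univ x ^ 2 * derivative p).natDegree <
          (potential x y r * p).natDegree := by
        refine lt_of_le_of_lt natDegree_mul_le ?_
        rw [h2, natDegree_pow, natDegree_nodal_univ]
        have := natDegree_derivative_lt hp
        omega
      rw [h, natDegree_add_eq_right_of_natDegree_lt h1, h2] at hV
      omega
    obtain ⟨c, rfl⟩ := natDegree_eq_zero.1 hp
    rw [derivative_C, mul_zero, zero_add] at h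
    rw [h, Polynomial.eval_mul, Polynomial.eval_C] at hVi
    rw [h, (mul_eq_zero.1 hVi).resolve_left (eval_potential_ne_zero hx (hy i) r),
      Polynomial.C_0, mul_zero]

end TwistedPolynomial

namespace RatWeyl

/-! ### Adjoining one variable -/

/-- The embedding of `ℂ(x_v : v ∈ σ)` into the rational functions in one more variable. -/
def extend {σ : Type} : RatField σ →+* RatField (Option σ) :=
  renameField some (Option.some_injective σ)

theorem ratDeriv_some_extend {σ : Type} (v : σ) (c : RatField σ) :
    ratDeriv (some v) (extend c) = extend (ratDeriv v c) :=
  ratDeriv_renameField _ _ _ _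

theorem ratDeriv_none_extend {σ : Type} (c : RatField σ) : ratDeriv none (extend c) = 0 :=
  ratDeriv_renameField_of_notMem _ _ (by simp) _

/-- Substitution of the new variable into a polynomial over `ℂ(x_v : v ∈ σ)`. -/
def evalNew {σ : Type} : Polynomial (RatField σ) →+* RatField (Option σ) :=
  Polynomial.eval₂RingHom extend (var none)

theorem evalNew_C {σ : Type} (c : RatField σ) : evalNew (Polynomial.C c) = extend c :=
  Polynomial.eval₂_C _ _

theorem evalNew_X {σ : Type} : evalNew (Polynomial.X : Polynomial (RatField σ)) = var none :=
  Polynomial.eval₂_X _ _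

theorem ratDeriv_evalNew {σ : Type} (p : Polynomial (RatField σ)) :
    ratDeriv none (evalNew p) = evalNew (Polynomial.derivative p) := by
  induction p using Polynomial.induction_on' with
  | add p q hp hq => simp only [map_add, hp, hq]
  | monomial k c =>
    rw [Polynomial.derivative_monomial, ← Polynomial.C_mul_X_pow_eq_monomial,
      ← Polynomial.C_mul_X_pow_eq_monomial]
    simp only [map_mul, map_pow, evalNew_C, evalNew_X, Derivation.leibniz, Derivation.leibniz_pow,
      ratDeriv_none_extend, ratDeriv_var_self, map_natCast, smul_eq_mul, nsmul_eq_mul]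
    ring

/-- A polynomial relation of least degree for the new variable could be differentiated. -/
theorem evalNew_injective {σ : Type} : Function.Injective (evalNew (σ := σ)) := by
  rw [injective_iff_map_eq_zero]
  intro p hp
  induction hk : p.natDegree using Nat.strong_induction_on generalizing p with
  | h k ih =>
    have hd : Polynomial.derivative p = 0 := by
      by_cases h0 : p.natDegree = 0
      · exact Polynomial.derivative_of_natDegree_zero h0
      · refine ih _ (hk ▸ Polynomial.natDegree_derivative_lt h0) _ ?_ rfl
        rw [← ratDeriv_evalNew, hp, map_zero]
    obtain ⟨c, rfl⟩ := Polynomial.natDegree_eq_zero.1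
      (Polynomial.derivative_eq_zero.1 hd)
    rw [evalNew_C] at hp
    rw [(map_eq_zero extend).1 hp, map_zero]

end RatWeyl

namespace RatWeyl

theorem ratDeriv_var {σ : Type} [DecidableEq σ] (v w : σ) :
    ratDeriv v (var w) = if w = v then 1 else 0 := by
  split_ifs with h
  · rw [h, ratDeriv_var_self]
  · exact ratDeriv_var_of_ne h

theorem ratDeriv_two {σ : Type} (v : σ) : ratDeriv v (2 : RatField σ) = 0 :=
  (ratDeriv v).map_natCast 2

theorem ratDeriv_four {σ : Type} (v : σ) : ratDeriv v (4 : RatField σ) = 0 :=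
  (ratDeriv v).map_natCast 4

end RatWeyl

namespace FisherBingham

open RatWeyl
open scoped MonomialOrder

/-! ### The integral representation -/

/-- The variable `s` of the integrand
`r e^{r² s} ∏_i (s - x_{ii})^{-1/2} e^{y_i² / (4 (s - x_{ii}))}`. -/
def s (n : ℕ) : RatField (Option (Var n)) := var none

/-- The linear form `s - x_{ii}`. -/
def lin {n : ℕ} (i : Fin (n + 1)) : RatField (Option (Var n)) := s n - extend (x i)

/-- The exponent of the integrand. -/
def phase (n : ℕ) : RatField (Option (Var n)) :=
  ∑ i, extend (y i) ^ 2 / (4 * lin i) + extend (r n) ^ 2 * s n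

/-- The action of `∂_v`, or of `∂/∂s`, on the multiples of
`e^{r² s} ∏_i (s - x_{ii})^{-1/2} e^{y_i² / (4 (s - x_{ii}))}`. -/
def T {n : ℕ} (u : Option (Var n)) : Module.End ℂ (RatField (Option (Var n))) :=
  twistedDeriv (phase n) lin u

/-- The factor by which `∂_{ii}` and `∂_i²` both act on
`e^{r² s} ∏_i (s - x_{ii})^{-1/2} e^{y_i² / (4 (s - x_{ii}))}`. -/
def xFactor {n : ℕ} (i : Fin (n + 1)) : RatField (Option (Var n)) :=
  extend (y i) ^ 2 / (4 * lin i ^ 2) + 1 / (2 * lin i)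

theorem lin_ne_zero {n : ℕ} (i : Fin (n + 1)) : lin i ≠ 0 := by
  have h : lin i = evalNew (Polynomial.X - Polynomial.C (x i)) := by
    rw [map_sub, evalNew_X, evalNew_C]
    rfl
  rw [h]
  exact (map_ne_zero_iff _ evalNew_injective).2 (Polynomial.X_sub_C_ne_zero _)

theorem T_apply {n : ℕ} (u : Option (Var n)) (f : RatField (Option (Var n))) :
    T u f = ratDeriv u f + (∑ i, (extend (y i) / (2 * lin i) * ratDeriv u (extend (y i)) -
      xFactor i * ratDeriv u (lin i)) + 2 * extend (r n) * s n * ratDeriv u (extend (r n)) +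
        extend (r n) ^ 2 * ratDeriv u (s n)) * f := by
  rw [T, twistedDeriv_apply]
  congr 2
  rw [phase, map_add, map_sum, Derivation.leibniz, Finset.mul_sum, add_sub_right_comm,
    ← Finset.sum_sub_distrib, add_assoc]
  congr 1
  · refine Finset.sum_congr rfl fun i _ => ?_
    have := lin_ne_zero i
    simp only [Derivation.leibniz_div, Derivation.leibniz, Derivation.leibniz_pow, smul_eq_mul,
      nsmul_eq_mul, ratDeriv_four, xFactor]
    push_cast
    field_simp
    ring
  · simp only [Derivation.leibniz_pow, smul_eq_mul, nsmul_eq_mul]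
    push_cast
    ring

theorem ratDeriv_s {n : ℕ} (v : Var n) : ratDeriv (some v) (s n) = 0 :=
  ratDeriv_var_of_ne (by simp)

theorem ratDeriv_none_s (n : ℕ) : ratDeriv none (s n) = 1 :=
  ratDeriv_var_self _

theorem T_yIdx {n : ℕ} (i : Fin (n + 1)) (f : RatField (Option (Var n))) :
    T (some (yIdx i)) f = ratDeriv (some (yIdx i)) f + extend (y i) / (2 * lin i) * f := by
  classical
  simp [T_apply, lin, ratDeriv_s, ratDeriv_some_extend, x, y, r, ratDeriv_var]

theorem T_xIdx {n : ℕ} (i : Fin (n + 1)) (f : RatField (Option (Var n))) :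
    T (some (xIdx i)) f = ratDeriv (some (xIdx i)) f + xFactor i * f := by
  classical
  simp [T_apply, lin, ratDeriv_s, ratDeriv_some_extend, x, y, r, ratDeriv_var]

theorem T_rIdx {n : ℕ} (f : RatField (Option (Var n))) :
    T (some (rIdx n)) f = ratDeriv (some (rIdx n)) f + 2 * extend (r n) * s n * f := by
  classical
  simp [T_apply, lin, ratDeriv_s, ratDeriv_some_extend, x, y, r, ratDeriv_var]

theorem T_none {n : ℕ} (f : RatField (Option (Var n))) :
    T none f = ratDeriv none f + (extend (r n) ^ 2 - ∑ i, xFactor i) * f := by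
  simp only [T_apply, lin, ratDeriv_none_s, ratDeriv_none_extend, map_sub, mul_zero, zero_sub,
    sub_zero, mul_one, Finset.sum_neg_distrib, add_zero]
  ring

theorem T_commute {n : ℕ} (u v : Option (Var n)) : Commute (T u) (T v) :=
  twistedDeriv_commute _ _ _ _

/-- The rational functions of `s` over `ℂ(x, y, r)` with poles at the points `x_{ii}` only. -/
def polar (n : ℕ) : Subring (RatField (Option (Var n))) :=
  Subring.closure (Set.range extend ∪ {s n} ∪ Set.range fun i => (lin i)⁻¹)

theorem extend_mem_polar {n : ℕ} (c : RatField (Var n)) : extend c ∈ polar n :=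
  Subring.subset_closure (Or.inl (Or.inl ⟨c, rfl⟩))

theorem s_mem_polar (n : ℕ) : s n ∈ polar n :=
  Subring.subset_closure (Or.inl (Or.inr rfl))

theorem lin_inv_mem_polar {n : ℕ} (i : Fin (n + 1)) : (lin i)⁻¹ ∈ polar n :=
  Subring.subset_closure (Or.inr ⟨i, rfl⟩)

theorem ratDeriv_extend_mem_polar {n : ℕ} (u : Option (Var n)) (c : RatField (Var n)) :
    ratDeriv u (extend c) ∈ polar n := by
  cases u with
  | none => rw [ratDeriv_none_extend]; exact zero_mem _
  | some v => rw [ratDeriv_some_extend]; exact extend_mem_polar _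

theorem ratDeriv_s_mem_polar {n : ℕ} (u : Option (Var n)) : ratDeriv u (s n) ∈ polar n := by
  cases u with
  | none => rw [ratDeriv_none_s]; exact one_mem _
  | some v => rw [ratDeriv_s]; exact zero_mem _

theorem ratDeriv_lin_mem_polar {n : ℕ} (u : Option (Var n)) (i : Fin (n + 1)) :
    ratDeriv u (lin i) ∈ polar n := by
  rw [lin, map_sub]
  exact sub_mem (ratDeriv_s_mem_polar u) (ratDeriv_extend_mem_polar u _)

theorem ratDeriv_mem_polar {n : ℕ} (u : Option (Var n)) {f : RatField (Option (Var n))}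
    (hf : f ∈ polar n) : ratDeriv u f ∈ polar n := by
  induction hf using Subring.closure_induction with
  | mem f hf =>
    rcases hf with (⟨c, rfl⟩ | rfl) | ⟨i, rfl⟩
    · exact ratDeriv_extend_mem_polar u c
    · exact ratDeriv_s_mem_polar u
    · dsimp only
      rw [Derivation.leibniz_inv, smul_eq_mul]
      exact mul_mem (neg_mem (pow_mem (lin_inv_mem_polar i) 2)) (ratDeriv_lin_mem_polar u i)
  | zero => rw [map_zero]; exact zero_mem _
  | one => rw [Derivation.map_one_eq_zero]; exact zero_mem _
  | add f g _ _ hf hg => rw [map_add]; exact add_mem hf hg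
  | neg f _ hf => rw [map_neg]; exact neg_mem hf
  | mul f g hf hg hf' hg' =>
    rw [Derivation.leibniz, smul_eq_mul, smul_eq_mul]
    exact add_mem (mul_mem hf hg') (mul_mem hg hf')

theorem xFactor_mem_polar {n : ℕ} (i : Fin (n + 1)) : xFactor i ∈ polar n := by
  have h : xFactor i = extend (y i ^ 2 / 4) * ((lin i)⁻¹) ^ 2 + extend 2⁻¹ * (lin i)⁻¹ := by
    have := lin_ne_zero i
    rw [xFactor, map_div₀, map_pow, map_inv₀, map_ofNat, map_ofNat]
    field_simp
  rw [h]
  exact add_mem (mul_mem (extend_mem_polar _) (pow_mem (lin_inv_mem_polar i) 2))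
    (mul_mem (extend_mem_polar _) (lin_inv_mem_polar i))

theorem T_mem_polar {n : ℕ} (u : Option (Var n)) {f : RatField (Option (Var n))}
    (hf : f ∈ polar n) : T u f ∈ polar n := by
  have h2 : (2 : RatField (Option (Var n))) ∈ polar n := ofNat_mem _ 2
  have hy : ∀ i : Fin (n + 1), extend (y i) / (2 * lin i) ∈ polar n := fun i => by
    have h : extend (y i) / (2 * lin i) = extend (y i / 2) * (lin i)⁻¹ := by
      rw [map_div₀, map_ofNat, div_mul_eq_div_div, div_eq_mul_inv]
    rw [h]
    exact mul_mem (extend_mem_polar _) (lin_inv_mem_polar i)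
  rw [T_apply]
  refine add_mem (ratDeriv_mem_polar u hf) (mul_mem (add_mem (add_mem (sum_mem fun i _ =>
    sub_mem (mul_mem (hy i) (ratDeriv_extend_mem_polar u _))
      (mul_mem (xFactor_mem_polar i) (ratDeriv_lin_mem_polar u i))) ?_) ?_) hf)
  · exact mul_mem (mul_mem (mul_mem h2 (extend_mem_polar _)) (s_mem_polar n))
      (ratDeriv_extend_mem_polar u _)
  · exact mul_mem (pow_mem (extend_mem_polar _) 2) (ratDeriv_s_mem_polar u)

/-- The total derivatives with respect to `s`; their integrals over cycles vanish. -/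
def exactForms (n : ℕ) : AddSubgroup (RatField (Option (Var n))) :=
  (polar n).toAddSubgroup.map (T none).toAddMonoidHom

theorem T_none_mem_exactForms {n : ℕ} {g : RatField (Option (Var n))} (hg : g ∈ polar n) :
    T none g ∈ exactForms n :=
  ⟨g, hg, rfl⟩

theorem extend_mul_mem_exactForms {n : ℕ} (c : RatField (Var n)) {f : RatField (Option (Var n))}
    (hf : f ∈ exactForms n) : extend c * f ∈ exactForms n := by
  obtain ⟨g, hg, rfl⟩ := hf
  have h : extend c * T none g = T none (extend c * g) := by
    rw [T, twistedDeriv_mul, ratDeriv_none_extend, zero_mul, add_zero]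
  change extend c * T none g ∈ _
  rw [h]
  exact T_none_mem_exactForms (mul_mem (extend_mem_polar c) hg)

theorem T_mem_exactForms {n : ℕ} (u : Option (Var n)) {f : RatField (Option (Var n))}
    (hf : f ∈ exactForms n) : T u f ∈ exactForms n := by
  obtain ⟨g, hg, rfl⟩ := hf
  have h : T u (T none g) = T none (T u g) := LinearMap.congr_fun (T_commute u none) g
  change T u (T none g) ∈ _
  rw [h]
  exact T_none_mem_exactForms (T_mem_polar u hg)

/-- The integrand obtained by applying an operator to
`r e^{r² s} ∏_i (s - x_{ii})^{-1/2} e^{y_i² / (4 (s - x_{ii}))}` and dividing by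
`e^{r² s} ∏_i (s - x_{ii})^{-1/2} e^{y_i² / (4 (s - x_{ii}))}`. -/
theorem exists_integrand (n : ℕ) : ∃ ψ : R (Var n) →+ RatField (Option (Var n)),
    ψ 1 = extend (r n) ∧ (∀ c P, ψ (fn c * P) = extend c * ψ P) ∧
      ∀ v P, ψ (del v * P) = T (some v) (ψ P) :=
  exists_intertwining extend (fun v => T (some v)) (fun _ _ => T_commute _ _)
    (fun v c g => by rw [T, twistedDeriv_mul, ratDeriv_some_extend]) _

/-- The map of `exists_integrand`. -/
def integrand (n : ℕ) : R (Var n) →+ RatField (Option (Var n)) :=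
  (exists_integrand n).choose

theorem integrand_one (n : ℕ) : integrand n 1 = extend (r n) :=
  (exists_integrand n).choose_spec.1

theorem integrand_fn_mul {n : ℕ} (c : RatField (Var n)) (P : R (Var n)) :
    integrand n (fn c * P) = extend c * integrand n P :=
  (exists_integrand n).choose_spec.2.1 c P

theorem integrand_fn {n : ℕ} (c : RatField (Var n)) :
    integrand n (fn c) = extend c * extend (r n) := by
  rw [← mul_one (fn c), integrand_fn_mul, integrand_one]

theorem integrand_del_mul {n : ℕ} (v : Var n) (P : R (Var n)) :
    integrand n (del v * P) = T (some v) (integrand n P) :=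
  (exists_integrand n).choose_spec.2.2 v P

theorem integrand_sub {n : ℕ} (P Q : R (Var n)) :
    integrand n (P - Q) = integrand n P - integrand n Q :=
  map_sub (integrand n) P Q

theorem integrand_dy {n : ℕ} (i : Fin (n + 1)) :
    integrand n (dy i) = extend (r n) * extend (y i) / (2 * lin i) := by
  classical
  rw [← mul_one (dy i), dy, integrand_del_mul, integrand_one, T_yIdx, ratDeriv_some_extend, r,
    ratDeriv_var, if_neg (by simp), map_zero, zero_add, mul_comm, mul_div_assoc]

theorem ratDeriv_yIdx_lin {n : ℕ} (i j : Fin (n + 1)) :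
    ratDeriv (some (yIdx i)) (lin j) = 0 := by
  classical
  simp [lin, ratDeriv_s, ratDeriv_some_extend, x, ratDeriv_var]

theorem integrand_dy_mul_dy {n : ℕ} (i j : Fin (n + 1)) :
    integrand n (dy i * dy j) = extend (r n) * (extend (y i) * extend (y j) / (4 * lin i * lin j) +
      if i = j then 1 / (2 * lin i) else 0) := by
  classical
  have hr : ratDeriv (some (yIdx i)) (extend (r n)) = 0 := by
    simp [ratDeriv_some_extend, r, ratDeriv_var]
  have hy : ratDeriv (some (yIdx i)) (extend (y j)) = if i = j then 1 else 0 := by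
    rw [ratDeriv_some_extend, y, ratDeriv_var]
    by_cases h : i = j
    · simp [h]
    · simp [h, Ne.symm h]
  have hi := lin_ne_zero i
  have hj := lin_ne_zero j
  rw [dy, integrand_del_mul, integrand_dy, T_yIdx]
  simp only [Derivation.leibniz_div, Derivation.leibniz, smul_eq_mul, ratDeriv_two, hr, hy,
    ratDeriv_yIdx_lin]
  split_ifs with h
  · subst h
    field_simp
    ring
  · field_simp
    ring

theorem integrand_dy_sq {n : ℕ} (i : Fin (n + 1)) :
    integrand n (dy i ^ 2) = extend (r n) * xFactor i := by
  have hi := lin_ne_zero i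
  rw [pow_two, integrand_dy_mul_dy, if_pos rfl, xFactor]
  field_simp

/-! ### The generators of the ideal annihilate the integral -/

theorem integrand_A {n : ℕ} (i : Fin (n + 1)) : integrand n (A i) = 0 := by
  classical
  have hr : ratDeriv (some (xIdx i)) (extend (r n)) = 0 := by
    simp [ratDeriv_some_extend, r, ratDeriv_var]
  have h : integrand n (A i) = integrand n (dx i * 1) - integrand n (dy i ^ 2) := by
    rw [mul_one, A, integrand_sub]
  rw [h, dx, integrand_del_mul, integrand_one, integrand_dy_sq, T_xIdx, hr]
  ring

theorem integrand_B (n : ℕ) : integrand n (B n) = -T none (extend (r n)) := by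
  have h : integrand n (B n) = ∑ i, integrand n (dy i ^ 2) - integrand n (fn (r n ^ 2)) := by
    rw [← map_sum, B, integrand_sub]
  rw [h, integrand_fn, T_none, ratDeriv_none_extend]
  simp only [integrand_dy_sq, map_pow, ← Finset.mul_sum]
  ring

theorem integrand_C {n : ℕ} {i j : Fin (n + 1)} (hij : i ≠ j) : integrand n (C i j) = 0 := by
  have hi := lin_ne_zero i
  have hj := lin_ne_zero j
  have ha : extend (a i j) = 2 * (lin j - lin i) := by
    simp only [a, lin, map_mul, map_sub, map_ofNat]
    ring
  have h : integrand n (C i j) = integrand n (fn (a i j) * (dy i * dy j)) +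
      integrand n (fn (y i) * dy j) - integrand n (fn (y j) * dy i) := by
    rw [← map_add, ← mul_assoc, C, integrand_sub]
  rw [h, integrand_fn_mul, integrand_fn_mul, integrand_fn_mul, integrand_dy_mul_dy, integrand_dy,
    integrand_dy, if_neg hij, ha]
  field_simp
  ring

theorem integrand_E (n : ℕ) : integrand n (E n) = T none (2 * s n * extend (r n)) := by
  classical
  have hr : ratDeriv (some (rIdx n)) (extend (r n)) = 1 := by
    simp [ratDeriv_some_extend, r, ratDeriv_var]
  have h : integrand n (E n) = integrand n (fn (r n) * (dr n * 1)) -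
      extend 2 * ∑ i, integrand n (fn (x i) * dy i ^ 2) -
        ∑ i, integrand n (fn (y i) * dy i) - integrand n (fn (n : RatField (Var n))) := by
    rw [← map_sum, ← map_sum, ← integrand_fn_mul, mul_one, map_natCast fn, map_ofNat fn, E,
      integrand_sub, integrand_sub, integrand_sub]
  have hterm : ∀ i : Fin (n + 1), 2 * (extend (x i) * (extend (r n) * xFactor i)) +
      extend (y i) * (extend (r n) * extend (y i) / (2 * lin i)) =
        extend (r n) * (2 * s n * xFactor i - 1) := fun i => by
    have hi := lin_ne_zero i
    have hx : extend (x i) = s n - lin i := by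
      rw [lin, sub_sub_cancel]
    rw [hx, xFactor]
    field_simp
    ring
  have hsum := Finset.sum_congr (rfl : (Finset.univ : Finset (Fin (n + 1))) = Finset.univ)
    fun i _ => hterm i
  rw [Finset.sum_add_distrib, ← Finset.mul_sum, ← Finset.mul_sum, Finset.sum_sub_distrib,
    ← Finset.mul_sum, Finset.sum_const, Finset.card_univ, Fintype.card_fin, nsmul_eq_mul] at hsum
  push_cast at hsum
  rw [h, dr, integrand_fn_mul, integrand_del_mul, integrand_one, integrand_fn, T_rIdx, hr, T_none]
  simp only [integrand_fn_mul, integrand_dy_sq, integrand_dy, map_ofNat, map_natCast,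
    Derivation.leibniz, smul_eq_mul, ratDeriv_two, ratDeriv_none_extend, ratDeriv_none_s]
  linear_combination -hsum

theorem integrand_mul_mem_exactForms {n : ℕ} (P : R (Var n)) {Q : R (Var n)}
    (hQ : integrand n Q ∈ exactForms n) : integrand n (P * Q) ∈ exactForms n := by
  refine mul_induction (p := fun Q => integrand n Q ∈ exactForms n) (fun P Q hP hQ => ?_)
    (fun c P hP => ?_) (fun v P hP => ?_) P hQ
  · rw [map_add]
    exact add_mem hP hQ
  · rw [integrand_fn_mul]
    exact extend_mul_mem_exactForms c hP
  · rw [integrand_del_mul]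
    exact T_mem_exactForms _ hP

theorem integrand_mem_exactForms {n : ℕ} {P : R (Var n)} (hP : P ∈ diagIdeal n) :
    integrand n P ∈ exactForms n := by
  induction hP using Submodule.span_induction with
  | mem P hP =>
    rcases hP with ((⟨i, rfl⟩ | rfl) | ⟨i, j, hij, rfl⟩) | rfl
    · rw [integrand_A]
      exact zero_mem _
    · rw [integrand_B]
      exact neg_mem (T_none_mem_exactForms (extend_mem_polar _))
    · rw [integrand_C hij.ne]
      exact zero_mem _
    · rw [integrand_E]
      exact T_none_mem_exactForms (mul_mem (mul_mem (ofNat_mem _ 2) (s_mem_polar n))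
        (extend_mem_polar _))
  | zero => rw [map_zero]; exact zero_mem _
  | add P Q _ _ hP hQ => rw [map_add]; exact add_mem hP hQ
  | smul P Q _ hQ => exact integrand_mul_mem_exactForms P hQ

/-! ### Pole orders of the integrands of the standard monomials -/

/-- The polynomial `∏_i (s - x_{ii})`. -/
def den (n : ℕ) : Polynomial (RatField (Var n)) := Lagrange.nodal Finset.univ x

/-- The polynomial `∏_{j ≠ i} (s - x_{jj})`. -/
def denErase {n : ℕ} (i : Fin (n + 1)) : Polynomial (RatField (Var n)) :=
  Lagrange.nodal (Finset.univ.erase i) x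

theorem x_injective {n : ℕ} : Function.Injective (x (n := n)) := fun i j h => by
  simpa using var_injective h

theorem evalNew_den {n : ℕ} (i : Fin (n + 1)) :
    evalNew (den n) = lin i * evalNew (denErase i) := by
  rw [den, Lagrange.nodal_eq_mul_nodal_erase (Finset.mem_univ i), map_mul, map_sub, evalNew_X,
    evalNew_C]
  rfl

theorem exists_mul_den_pow_eq {n : ℕ} {f : RatField (Option (Var n))} (hf : f ∈ polar n) :
    ∃ (m : ℕ) (p : Polynomial (RatField (Var n))), f * evalNew (den n) ^ m = evalNew p := by
  induction hf using Subring.closure_induction with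
  | mem f hf =>
    rcases hf with (⟨c, rfl⟩ | rfl) | ⟨i, rfl⟩
    · exact ⟨0, Polynomial.C c, by rw [pow_zero, mul_one, evalNew_C]⟩
    · exact ⟨0, Polynomial.X, by rw [pow_zero, mul_one, evalNew_X]; rfl⟩
    · exact ⟨1, denErase i, by rw [pow_one, evalNew_den i, inv_mul_cancel_left₀ (lin_ne_zero i)]⟩
  | zero => exact ⟨0, 0, by simp⟩
  | one => exact ⟨0, 1, by simp⟩
  | add f g _ _ hf hg =>
    obtain ⟨a, p, hp⟩ := hf
    obtain ⟨b, q, hq⟩ := hg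
    refine ⟨a + b, p * den n ^ b + q * den n ^ a, ?_⟩
    rw [map_add, map_mul, map_mul, map_pow, map_pow, ← hp, ← hq]
    ring
  | neg f _ hf =>
    obtain ⟨a, p, hp⟩ := hf
    exact ⟨a, -p, by rw [map_neg, ← hp, neg_mul]⟩
  | mul f g _ _ hf hg =>
    obtain ⟨a, p, hp⟩ := hf
    obtain ⟨b, q, hq⟩ := hg
    refine ⟨a + b, p * q, ?_⟩
    rw [map_mul, ← hp, ← hq]
    ring

theorem evalNew_potential (n : ℕ) : evalNew (potential x y (r n)) =
    (extend (r n) ^ 2 - ∑ i, xFactor i) * evalNew (den n) ^ 2 := by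
  rw [potential, map_sub, map_mul, map_pow, map_pow, evalNew_C, map_pow, map_sum, sub_mul,
    Finset.sum_mul]
  congr 1
  refine Finset.sum_congr rfl fun i _ => ?_
  have hi := lin_ne_zero i
  change evalNew (_ * denErase i ^ 2 + _ * den n * denErase i) = _
  rw [map_add, map_mul, map_mul, map_mul, map_pow, evalNew_C, evalNew_C, map_div₀, map_inv₀,
    map_pow, map_ofNat, map_ofNat, evalNew_den i, xFactor]
  field_simp

/-- A total derivative with at most double poles at the `x_{ii}` that is bounded at infinity and
has at most a simple pole at one of the `x_{ii}` vanishes. -/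
theorem eq_zero_of_mem_exactForms {n : ℕ} {V : Polynomial (RatField (Var n))}
    {f : RatField (Option (Var n))} (hf : f ∈ exactForms n)
    (hV : f * evalNew (den n) ^ 2 = evalNew V) (hdeg : V.natDegree ≤ 2 * (n + 1))
    {i : Fin (n + 1)} (hi : V.eval (x i) = 0) : V = 0 := by
  obtain ⟨g, hg, rfl⟩ := hf
  obtain ⟨m, p, hp⟩ := exists_mul_den_pow_eq hg
  change T none g * _ = _ at hV
  refine eq_zero_of_eq_twisted_derivative x_injective (fun i => var_ne_zero (yIdx i))
    (var_ne_zero (rIdx n)) (by rwa [Fintype.card_fin]) hi m p (evalNew_injective ?_)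
  change evalNew (V * den n ^ m) = evalNew (den n ^ 2 * _ -
    _ * den n * Polynomial.derivative (den n) * _ + potential x y (r n) * p)
  have hd : ratDeriv none g * evalNew (den n) ^ (m + 1) =
      evalNew (den n) * evalNew (Polynomial.derivative p) -
        m * evalNew (Polynomial.derivative (den n)) * evalNew p := by
    have h := congrArg (ratDeriv none) hp
    rw [Derivation.leibniz, Derivation.leibniz_pow, ratDeriv_evalNew, ratDeriv_evalNew] at h
    simp only [smul_eq_mul, nsmul_eq_mul] at h
    -- for `m = 0` both sides vanish, whatever the truncated exponent
    have hm : (m : RatField (Option (Var n))) * evalNew (den n) ^ m =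
        m * (evalNew (den n) * evalNew (den n) ^ (m - 1)) := by
      cases m with
      | zero => simp
      | succ m => rw [Nat.add_sub_cancel, pow_succ']
    rw [← h, ← hp]
    linear_combination g * evalNew (Polynomial.derivative (den n)) * hm
  rw [T_none] at hV
  simp only [map_mul, map_add, map_sub, map_pow, map_natCast, ← hV, evalNew_potential, ← hp] at hd ⊢
  linear_combination evalNew (den n) * hd

theorem natDegree_den (n : ℕ) : (den n).natDegree = n + 1 := by
  rw [den, natDegree_nodal_univ, Fintype.card_fin]

theorem natDegree_denErase {n : ℕ} (i : Fin (n + 1)) : (denErase i).natDegree = n := by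
  have := natDegree_nodal_erase_add_one x i
  rw [Fintype.card_fin] at this
  exact Nat.succ_injective this

theorem eval_den {n : ℕ} (k : Fin (n + 1)) : (den n).eval (x k) = 0 :=
  eval_nodal_univ x k

theorem eval_derivative_den {n : ℕ} (k : Fin (n + 1)) :
    (Polynomial.derivative (den n)).eval (x k) = (denErase k).eval (x k) :=
  Lagrange.eval_nodal_derivative_eval_node_eq (Finset.mem_univ k)

theorem eval_denErase_of_ne {n : ℕ} {i k : Fin (n + 1)} (h : k ≠ i) :
    (denErase i).eval (x k) = 0 :=
  eval_nodal_erase_of_ne x h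

theorem eval_denErase_self_ne_zero {n : ℕ} (i : Fin (n + 1)) : (denErase i).eval (x i) ≠ 0 :=
  eval_nodal_erase_self_ne_zero x_injective i

theorem exists_eq_of_degree_le_two {ι : Type} {γ : ι →₀ ℕ} (h : γ.degree ≤ 2) :
    γ = 0 ∨ (∃ i, γ = Finsupp.single i 1) ∨
      ∃ i j, γ = Finsupp.single i 1 + Finsupp.single j 1 := by
  classical
  have step : ∀ δ : ι →₀ ℕ, δ = 0 ∨ ∃ i δ', δ = Finsupp.single i 1 + δ' ∧
      δ.degree = 1 + δ'.degree := by
    intro δ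
    rcases eq_or_ne δ 0 with h | h
    · exact Or.inl h
    · obtain ⟨i, hi⟩ := DFunLike.ne_iff.1 h
      have hle : Finsupp.single i 1 ≤ δ :=
        Finsupp.single_le_iff.2 (Nat.one_le_iff_ne_zero.2 hi)
      have hadd : δ = Finsupp.single i 1 + (δ - Finsupp.single i 1) :=
        (add_tsub_cancel_of_le hle).symm
      refine Or.inr ⟨i, _, hadd, ?_⟩
      conv_lhs => rw [hadd, map_add, Finsupp.degree_single]
  rcases step γ with h0 | ⟨i, δ, rfl, hδ⟩
  · exact Or.inl h0
  rcases step δ with rfl | ⟨j, ε, rfl, hε⟩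
  · exact Or.inr (Or.inl ⟨i, add_zero _⟩)
  · have : ε = 0 := (Finsupp.degree_eq_zero_iff ε).1 (by omega)
    exact Or.inr (Or.inr ⟨i, j, by rw [this, add_zero]⟩)

/-- The polynomial numerator `q` of the integrand of a monomial in the `∂_i` of degree at most two,
over the denominator `∏_i (s - x_{ii})²`. Its values at the `x_{kk}` detect the squares `∂_k²`;
among monomials of degree at most one, its derivatives at the `x_{kk}` detect the `∂_k`. -/
theorem exists_numerator {n : ℕ} {γ : Fin (n + 1) →₀ ℕ} (hγ : γ.degree ≤ 2) :
    ∃ q : Polynomial (RatField (Var n)),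
      integrand n (delPow (yExp γ)) * evalNew (den n) ^ 2 = evalNew q ∧
      q.natDegree ≤ 2 * (n + 1) ∧ q ≠ 0 ∧
      (∀ k, q.eval (x k) ≠ 0 ↔ γ = Finsupp.single k 2) ∧
      (γ.degree ≤ 1 → ∀ k, (Polynomial.derivative q).eval (x k) ≠ 0 ↔ γ = Finsupp.single k 1) := by
  have hr : r n ≠ 0 := var_ne_zero _
  have hy : ∀ i : Fin (n + 1), y i ≠ 0 := fun i => var_ne_zero _
  have hden : den n ≠ 0 := Lagrange.nodal_ne_zero
  have herase : ∀ i : Fin (n + 1), denErase i ≠ 0 := fun i => Lagrange.nodal_ne_zero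
  have hdeg : ∀ {γ δ : Fin (n + 1) →₀ ℕ}, γ.degree ≠ δ.degree → γ ≠ δ :=
    fun h h' => h (by rw [h'])
  rcases exists_eq_of_degree_le_two hγ with rfl | ⟨i, rfl⟩ | ⟨i, j, rfl⟩
  · refine ⟨Polynomial.C (r n) * den n ^ 2, ?_, ?_, ?_, fun k => ?_, fun _ k => ?_⟩
    · rw [map_zero, delPow_zero, integrand_one, map_mul, evalNew_C, map_pow]
    · refine (Polynomial.natDegree_C_mul_le _ _).trans ?_
      rw [Polynomial.natDegree_pow, natDegree_den]
    · exact mul_ne_zero (Polynomial.C_ne_zero.2 hr) (pow_ne_zero 2 hden)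
    · simpa [eval_den] using hdeg (by simp)
    · simpa [eval_den, Polynomial.derivative_mul, Polynomial.derivative_pow] using hdeg (by simp)
  · refine ⟨Polynomial.C (r n * y i / 2) * (den n * denErase i), ?_, ?_, ?_, fun k => ?_,
      fun _ k => ?_⟩
    · have hi := lin_ne_zero i
      rw [delPow_yExp_single_one, integrand_dy]
      simp only [map_mul, evalNew_C, map_div₀, map_ofNat, evalNew_den i]
      field_simp
    · refine (Polynomial.natDegree_C_mul_le _ _).trans (Polynomial.natDegree_mul_le.trans ?_)
      rw [natDegree_den, natDegree_denErase]
      omega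
    · exact mul_ne_zero (Polynomial.C_ne_zero.2 (div_ne_zero (mul_ne_zero hr (hy i)) two_ne_zero))
        (mul_ne_zero hden (herase i))
    · simpa [eval_den] using hdeg (by simp)
    · rcases eq_or_ne k i with rfl | h
      · simp [eval_den, Polynomial.derivative_mul, eval_derivative_den,
          eval_denErase_self_ne_zero, hr, hy]
      · simp [eval_den, Polynomial.derivative_mul, eval_denErase_of_ne h,
          Finsupp.single_left_inj, h.symm]
  · refine ⟨Polynomial.C (r n * y i * y j / 4) * (denErase i * denErase j) +
      (if i = j then Polynomial.C (r n / 2) * (den n * denErase i) else 0), ?_, ?_, ?_⟩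
    · have hi := lin_ne_zero i
      have hj := lin_ne_zero j
      rw [delPow_yExp_single_add_single, pow_one, pow_one, integrand_dy_mul_dy]
      split_ifs with h
      · subst h
        simp only [map_add, map_mul, evalNew_C, map_div₀, map_ofNat, evalNew_den i]
        field_simp
      · have hw : evalNew (den n) ^ 2 =
            lin i * evalNew (denErase i) * (lin j * evalNew (denErase j)) := by
          rw [← evalNew_den, ← evalNew_den, pow_two]
        simp only [map_mul, evalNew_C, map_div₀, map_ofNat, hw, add_zero]
        field_simp
    · refine Polynomial.natDegree_add_le_of_degree_le ?_ ?_
      · refine (Polynomial.natDegree_C_mul_le _ _).trans (Polynomial.natDegree_mul_le.trans ?_)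
        rw [natDegree_denErase, natDegree_denErase]
        omega
      · split_ifs
        · refine (Polynomial.natDegree_C_mul_le _ _).trans (Polynomial.natDegree_mul_le.trans ?_)
          rw [natDegree_den, natDegree_denErase]
          omega
        · simp
    · rcases eq_or_ne i j with rfl | h
      · have hval : ∀ k, (Polynomial.C (r n * y i * y i / 4) * (denErase i * denErase i) +
            (if i = i then Polynomial.C (r n / 2) * (den n * denErase i) else 0)).eval (x k) ≠ 0 ↔
              Finsupp.single i 1 + Finsupp.single i 1 = Finsupp.single k 2 := by
          intro k
          rw [← Finsupp.single_add]
          rcases eq_or_ne k i with rfl | h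
          · simp [eval_den, eval_denErase_self_ne_zero, hr, hy]
          · simp [eval_denErase_of_ne h, Finsupp.single_left_inj, h.symm]
        refine ⟨fun h0 => (hval i).2 (Finsupp.single_add _ _ _).symm ?_, hval, fun h => ?_⟩
        · rw [h0, Polynomial.eval_zero]
        · simp at h
      · rw [if_neg h, add_zero]
        refine ⟨mul_ne_zero (Polynomial.C_ne_zero.2 (div_ne_zero (mul_ne_zero (mul_ne_zero hr
          (hy i)) (hy j)) (by norm_num))) (mul_ne_zero (herase i) (herase j)), fun k => ?_,
            fun h => ?_⟩
        · have hne : Finsupp.single i 1 + Finsupp.single j 1 ≠ Finsupp.single k 2 := fun h' => by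
            have h1 := DFunLike.congr_fun h' i
            simp only [Finsupp.add_apply, Finsupp.single_eq_same,
              Finsupp.single_eq_of_ne h] at h1
            rcases eq_or_ne i k with rfl | h2
            · simp at h1
            · simp [Finsupp.single_eq_of_ne h2] at h1
          refine iff_of_false (not_not.2 ?_) hne
          rcases eq_or_ne k i with rfl | h'
          · simp [eval_denErase_of_ne h]
          · simp [eval_denErase_of_ne h']
        · simp at h

/-! ### The Gröbner basis -/

theorem D_mem_diagIdeal {n : ℕ} (k : Fin (n + 1)) : D k ∈ diagIdeal n := by
  have hB : B n ∈ diagIdeal n := Ideal.subset_span (Or.inl (Or.inl (Or.inr rfl)))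
  have hsum : ∑ l ∈ Finset.Iio k, dy l * fn (a l k)⁻¹ * C l k ∈ diagIdeal n :=
    sum_mem fun l hl => Ideal.mul_mem_left _ _
      (Ideal.subset_span (Or.inl (Or.inr ⟨l, k, Finset.mem_Iio.1 hl, rfl⟩)))
  -- left ideals are submodules over the semiring of operators, hence a sum instead of a difference
  have hD : D k = dy k * B n +
      fn (-1) * ∑ l ∈ Finset.Iio k, dy l * fn (a l k)⁻¹ * C l k := by
    have h : ∀ Q S : R (Var n), Q - S = Q + fn (-1) * S := fun Q S => by
      have h0 : fn (-1) * S + fn 1 * S = 0 := by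
        rw [← add_mul, ← map_add, neg_add_cancel, map_zero, zero_mul]
      rw [map_one, one_mul] at h0
      have h1 : Q - S = Q + fn (-1) * S - (fn (-1) * S + S) := by abel
      rw [h1, h0, operator_sub_zero]
    rw [D, h]
  rw [hD]
  exact add_mem (Ideal.mul_mem_left _ _ hB) (Ideal.mul_mem_left _ _ hsum)

theorem span_basis (n : ℕ) : Ideal.span (basis n) = diagIdeal n := by
  refine le_antisymm (Ideal.span_le.2 ?_) (Ideal.span_mono ?_)
  · rintro P ((h | ⟨k, rfl⟩) | h)
    · exact Ideal.subset_span (Or.inl h)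
    · exact D_mem_diagIdeal k
    · exact Ideal.subset_span (Or.inr h)
  · rintro P (h | h)
    · exact Or.inl (Or.inl h)
    · exact Or.inr h

theorem finite_basis (n : ℕ) : (basis n).Finite := by
  have hC : {P | ∃ i j : Fin (n + 1), i < j ∧ P = C i j}.Finite :=
    (Set.finite_range fun p : Fin (n + 1) × Fin (n + 1) => C p.1 p.2).subset
      fun P ⟨i, j, _, h⟩ => ⟨(i, j), h.symm⟩
  exact ((((Set.finite_range A).union (Set.finite_singleton _)).union hC).union
    (Set.finite_range D)).union (Set.finite_singleton _)

/-- No element of the ideal has the leading monomial `1`, `η_k` or, for `k ≠ 1`, `η_k²`: its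
integrand is a total derivative with at most a simple pole at `x_{11}`, hence zero, whereas the
leading monomial, unless it is `1`, contributes the largest pole at `x_{kk}`. -/
theorem degree_symbol_ne_of_mem_diagIdeal {n : ℕ} {P : R (Var n)} (hP : P ∈ diagIdeal n)
    (hP0 : P ≠ 0) {k : Fin (n + 1)} {m : ℕ} (hm : m ≤ 1 ∨ m = 2 ∧ k ≠ 0) :
    (order n).degree (symbol P) ≠ yExp (Finsupp.single k m) := by
  intro hlead
  have hsymb : symbol P ≠ 0 := (map_ne_zero_iff _ (symbol (σ := Var n)).injective).2 hP0
  have hmem : yExp (Finsupp.single k m) ∈ (symbol P).support :=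
    hlead ▸ (order n).degree_mem_support hsymb
  have hex : ∀ α ∈ (symbol P).support, ∃ γ q, α = yExp γ ∧
      γ ≼[MonomialOrder.degLex] Finsupp.single k m ∧
      integrand n (delPow (yExp γ)) * evalNew (den n) ^ 2 = evalNew q ∧
      q.natDegree ≤ 2 * (n + 1) ∧ q ≠ 0 ∧
      (∀ k, q.eval (x k) ≠ 0 ↔ γ = Finsupp.single k 2) ∧
      (γ.degree ≤ 1 → ∀ k, (Polynomial.derivative q).eval (x k) ≠ 0 ↔
        γ = Finsupp.single k 1) := by
    intro α hα
    have hle : α ≼[order n] yExp (Finsupp.single k m) := hlead ▸ (order n).le_degree hα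
    obtain ⟨γ, rfl, hγ⟩ : ∃ γ, α = yExp γ ∧ γ ≼[MonomialOrder.degLex] Finsupp.single k m := by
      rcases hle.eq_or_lt with h | h
      · exact ⟨_, (order n).toSyn.injective h, le_rfl⟩
      · obtain ⟨γ, hγ, hlt⟩ := (lt_yExp_iff _ _).1 h
        exact ⟨γ, hγ, hlt.le⟩
    have hdeg := degree_le_of_degLex_le hγ
    rw [Finsupp.degree_single] at hdeg
    obtain ⟨q, hq⟩ := exists_numerator (γ := γ) (by omega)
    exact ⟨γ, q, rfl, hγ, hq⟩
  choose! γ q hγ hle hq hqdeg hq0 hval hder using hex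
  have hγk : γ (yExp (Finsupp.single k m)) = Finsupp.single k m :=
    (yExp_injective (hγ _ hmem)).symm
  have hinj : ∀ α ∈ (symbol P).support, γ α = Finsupp.single k m →
      α = yExp (Finsupp.single k m) := fun α hα h => by rw [hγ α hα, h]
  have hdegree : ∀ α ∈ (symbol P).support, (γ α).degree ≤ m := fun α hα => by
    simpa using degree_le_of_degLex_le (hle α hα)
  let V : Polynomial (RatField (Var n)) :=
    ∑ α ∈ (symbol P).support, Polynomial.C ((symbol P).coeff α) * q α
  have hcoeff : (symbol P).coeff (yExp (Finsupp.single k m)) ≠ 0 := mem_support_iff.1 hmem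
  have hV : V = 0 := by
    refine eq_zero_of_mem_exactForms (integrand_mem_exactForms hP) ?_ ?_ (i := 0) ?_
    · conv_lhs => rw [← ofSymbol_symbol P, ofSymbol_eq_sum]
      rw [map_sum, map_sum, Finset.sum_mul]
      refine Finset.sum_congr rfl fun α hα => ?_
      rw [integrand_fn_mul, map_mul, evalNew_C, mul_assoc, ← hq α hα, ← hγ α hα]
    · exact Polynomial.natDegree_sum_le_of_forall_le _ _ fun α hα =>
        (Polynomial.natDegree_C_mul_le _ _).trans (hqdeg α hα)
    · rw [Polynomial.eval_finsetSum]
      refine Finset.sum_eq_zero fun α hα => ?_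
      rw [Polynomial.eval_mul, mul_eq_zero]
      refine Or.inr (not_not.1 fun h => ?_)
      have h2 := (hval α hα 0).1 h
      have h1 := hdegree α hα
      rw [h2, Finsupp.degree_single] at h1
      obtain ⟨rfl, hk⟩ : m = 2 ∧ k ≠ 0 := hm.resolve_left (by omega)
      have h3 := hle α hα
      rw [h2] at h3
      exact not_lt_of_ge h3 (degLex_single_two_lt (Fin.pos_iff_ne_zero.2 hk))
  obtain rfl | rfl | rfl : m = 0 ∨ m = 1 ∨ m = 2 := by omega
  · have hall : V = Polynomial.C ((symbol P).coeff (yExp (Finsupp.single k 0))) *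
        q (yExp (Finsupp.single k 0)) := by
      refine Finset.sum_eq_single_of_mem _ hmem fun α hα hne => (hne (hinj α hα ?_)).elim
      rw [Finsupp.single_zero, ← Finsupp.degree_eq_zero_iff]
      exact Nat.le_zero.1 (hdegree α hα)
    exact mul_ne_zero (Polynomial.C_ne_zero.2 hcoeff) (hq0 _ hmem) (hall ▸ hV)
  · have hall : (Polynomial.derivative V).eval (x k) =
        (symbol P).coeff (yExp (Finsupp.single k 1)) *
          (Polynomial.derivative (q (yExp (Finsupp.single k 1)))).eval (x k) := by
      rw [Polynomial.derivative_sum, Polynomial.eval_finsetSum]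
      simp only [Polynomial.derivative_C_mul, Polynomial.eval_mul, Polynomial.eval_C]
      refine Finset.sum_eq_single_of_mem _ hmem fun α hα hne => mul_eq_zero.2 (Or.inr ?_)
      exact not_not.1 fun h => hne (hinj α hα ((hder α hα (hdegree α hα) k).1 h))
    rw [hV, Polynomial.derivative_zero, Polynomial.eval_zero] at hall
    refine mul_ne_zero hcoeff ((hder _ hmem (hdegree _ hmem) k).2 hγk) hall.symm
  · have hall : V.eval (x k) = (symbol P).coeff (yExp (Finsupp.single k 2)) *
        (q (yExp (Finsupp.single k 2))).eval (x k) := by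
      rw [Polynomial.eval_finsetSum]
      simp only [Polynomial.eval_mul, Polynomial.eval_C]
      refine Finset.sum_eq_single_of_mem _ hmem fun α hα hne => mul_eq_zero.2 (Or.inr ?_)
      exact not_not.1 fun h => hne (hinj α hα ((hval α hα k).1 h))
    rw [hV, Polynomial.eval_zero] at hall
    exact mul_ne_zero hcoeff ((hval _ hmem k).2 hγk) hall.symm

theorem exists_eq_yExp {n : ℕ} {α : Var n →₀ ℕ} (hr : α (rIdx n) = 0)
    (hx : ∀ i : Fin (n + 1), α (xIdx i) = 0) : ∃ β, α = yExp β := by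
  obtain ⟨⟨u, w⟩, rfl⟩ := Finsupp.sumFinsuppAddEquivProdFinsupp.symm.surjective α
  obtain ⟨⟨v, β⟩, rfl⟩ := Finsupp.sumFinsuppAddEquivProdFinsupp.symm.surjective w
  have hu : u = 0 := Finsupp.ext fun _ => hr
  have hv : v = 0 := Finsupp.ext hx
  exact ⟨β, by rw [yExp_eq_symm, hu, hv]⟩

theorem yExp_mono {n : ℕ} {β γ : Fin (n + 1) →₀ ℕ} (h : β ≤ γ) : yExp β ≤ yExp γ := by
  rw [← add_tsub_cancel_of_le h, map_add]
  exact le_self_add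

theorem exists_eq_single_or_exists_lt {n : ℕ} (β : Fin (n + 1) →₀ ℕ) :
    (∃ k m, β = Finsupp.single k m) ∨
      ∃ i j, i < j ∧ Finsupp.single i 1 + Finsupp.single j 1 ≤ β := by
  by_cases h : ∃ i j, i < j ∧ β i ≠ 0 ∧ β j ≠ 0
  · obtain ⟨i, j, hij, hi, hj⟩ := h
    refine Or.inr ⟨i, j, hij, fun l => ?_⟩
    rw [Finsupp.add_apply, Finsupp.single_apply, Finsupp.single_apply]
    split_ifs with h1 h2 h2
    · exact (hij.ne (h1.trans h2.symm)).elim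
    · subst h1; omega
    · subst h2; omega
    · omega
  · left
    rcases eq_or_ne β 0 with rfl | h0
    · exact ⟨0, 0, by simp⟩
    · obtain ⟨k, hk⟩ := DFunLike.ne_iff.1 h0
      refine ⟨k, β k, Finsupp.ext fun l => ?_⟩
      rw [Finsupp.single_apply]
      split_ifs with hl
      · rw [hl]
      · by_contra hl0
        rcases lt_or_gt_of_ne hl with h' | h'
        · exact h ⟨k, l, h', hk, hl0⟩
        · exact h ⟨l, k, h', hl0, hk⟩

theorem monomial_mem_span {σ : Type} {K : Type} [Field K] {S : Set (MvPolynomial σ K)}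
    {α β : σ →₀ ℕ} {c : K} (hc : c ≠ 0) (hS : monomial α c ∈ S) (h : α ≤ β) (d : K) :
    monomial β d ∈ Ideal.span S := by
  have : monomial β d = monomial (β - α) (d / c) * monomial α c := by
    rw [monomial_mul, tsub_add_cancel_of_le h, div_mul_cancel₀ d hc]
  rw [this]
  exact Ideal.mul_mem_left _ _ (Ideal.subset_span hS)

theorem initTerm_mem_span {n : ℕ} {P : R (Var n)} (hP : P ∈ diagIdeal n) (hP0 : P ≠ 0) :
    initTerm (order n) P ∈ Ideal.span (initTerm (order n) '' basis n) := by
  have hred : ∀ {Q : R (Var n)} {α c}, Q ∈ basis n → c ≠ 0 →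
      Q - fn c * delPow α ∈ below (order n) α → α ≤ (order n).degree (symbol P) →
        initTerm (order n) P ∈ Ideal.span (initTerm (order n) '' basis n) :=
    fun hQ hc hQ' hα =>
      monomial_mem_span hc (initTerm_eq hc hQ' ▸ Set.mem_image_of_mem _ hQ) hα _
  by_cases hr : (order n).degree (symbol P) (rIdx n) = 0
  swap
  · exact hred (Or.inr rfl) (var_ne_zero _) (E_sub_mem_below n)
      (Finsupp.single_le_iff.2 (Nat.one_le_iff_ne_zero.2 hr))
  by_cases hx : ∀ i, (order n).degree (symbol P) (xIdx i) = 0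
  swap
  · obtain ⟨i, hi⟩ := not_forall.1 hx
    exact hred (Or.inl (Or.inl (Or.inl (Or.inl ⟨i, rfl⟩)))) one_ne_zero (A_sub_mem_below i)
      (Finsupp.single_le_iff.2 (Nat.one_le_iff_ne_zero.2 hi))
  obtain ⟨β, hβ⟩ := exists_eq_yExp hr hx
  rcases exists_eq_single_or_exists_lt β with ⟨k, m, rfl⟩ | ⟨i, j, hij, h⟩
  · by_cases h3 : 3 ≤ m
    · refine hred (Or.inl (Or.inr ⟨k, rfl⟩)) one_ne_zero (D_sub_mem_below k) ?_
      rw [hβ]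
      exact yExp_mono (Finsupp.single_mono h3)
    by_cases h2 : m ≤ 1 ∨ m = 2 ∧ k ≠ 0
    · exact (degree_symbol_ne_of_mem_diagIdeal hP hP0 h2 hβ).elim
    obtain ⟨rfl, rfl⟩ : m = 2 ∧ k = 0 := by
      rw [not_or, not_and, not_not] at h2
      have hm : m = 2 := by omega
      exact ⟨hm, h2.2 hm⟩
    refine hred (Or.inl (Or.inl (Or.inl (Or.inr rfl)))) one_ne_zero (B_sub_mem_below n) ?_
    rw [hβ]
  · refine hred (Or.inl (Or.inl (Or.inr ⟨i, j, hij, rfl⟩))) (a_ne_zero hij.ne)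
      (C_sub_mem_below i j) ?_
    rw [hβ]
    exact yExp_mono h

theorem ne_zero_of_sub_mem_below {σ : Type} [Fintype σ] {m : MonomialOrder σ} {α : σ →₀ ℕ}
    {c : RatField σ} (hc : c ≠ 0) {P : R σ} (hP : P - fn c * delPow α ∈ below m α) : P ≠ 0 := by
  rintro rfl
  have := (degree_symbol_eq hc hP).2
  rw [map_zero, coeff_zero] at this
  exact hc this.symm

theorem ne_zero_of_mem_basis {n : ℕ} {P : R (Var n)} (hP : P ∈ basis n) : P ≠ 0 := by
  rcases hP with (((⟨i, rfl⟩ | rfl) | ⟨i, j, hij, rfl⟩) | ⟨k, rfl⟩) | rfl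
  · exact ne_zero_of_sub_mem_below one_ne_zero (A_sub_mem_below i)
  · exact ne_zero_of_sub_mem_below one_ne_zero (B_sub_mem_below n)
  · exact ne_zero_of_sub_mem_below (a_ne_zero hij.ne) (C_sub_mem_below i j)
  · exact ne_zero_of_sub_mem_below one_ne_zero (D_sub_mem_below k)
  · exact ne_zero_of_sub_mem_below (var_ne_zero _) (E_sub_mem_below n)

theorem isGroebnerBasis_basis (n : ℕ) : IsGroebnerBasis (order n) (diagIdeal n) (basis n) where
  finite := finite_basis n
  span_eq := span_basis n
  span_initTerm_eq := by
    refine le_antisymm (Ideal.span_mono (Set.image_mono fun P hP => ⟨?_, ?_⟩)) (Ideal.span_le.2 ?_)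
    · exact span_basis n ▸ Ideal.subset_span hP
    · exact ne_zero_of_mem_basis hP
    · rintro _ ⟨P, ⟨hP, hP0⟩, rfl⟩
      exact initTerm_mem_span hP hP0

end FisherBingham

end

theorem proposition3 (n : ℕ) :
    RatWeyl.IsGroebnerBasis (FisherBingham.order n) (FisherBingham.diagIdeal n)
      (FisherBingham.basis n) ∧
    -- the initial monomials
    (∀ i : Fin (n + 1),
      RatWeyl.initMonomial (FisherBingham.order n) (FisherBingham.A i) = FisherBingham.ξ i) ∧
    RatWeyl.initMonomial (FisherBingham.order n) (FisherBingham.B n) =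
      FisherBingham.η (0 : Fin (n + 1)) ^ 2 ∧
    (∀ i j : Fin (n + 1), i < j →
      RatWeyl.initMonomial (FisherBingham.order n) (FisherBingham.C i j) =
        FisherBingham.η i * FisherBingham.η j) ∧
    (∀ k : Fin (n + 1),
      RatWeyl.initMonomial (FisherBingham.order n) (FisherBingham.D k) = FisherBingham.η k ^ 3) ∧
    RatWeyl.initMonomial (FisherBingham.order n) (FisherBingham.E n) = FisherBingham.ι n ∧
    -- the initial terms, that is, the initial monomials with their coefficients
    (∀ i : Fin (n + 1),
      RatWeyl.initTerm (FisherBingham.order n) (FisherBingham.A i) = FisherBingham.ξ i) ∧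
    RatWeyl.initTerm (FisherBingham.order n) (FisherBingham.B n) =
      FisherBingham.η (0 : Fin (n + 1)) ^ 2 ∧
    (∀ i j : Fin (n + 1), i < j →
      RatWeyl.initTerm (FisherBingham.order n) (FisherBingham.C i j) =
        MvPolynomial.C (FisherBingham.a i j) * FisherBingham.η i * FisherBingham.η j) ∧
    (∀ k : Fin (n + 1),
      RatWeyl.initTerm (FisherBingham.order n) (FisherBingham.D k) = FisherBingham.η k ^ 3) ∧
    RatWeyl.initTerm (FisherBingham.order n) (FisherBingham.E n) =
      MvPolynomial.C (FisherBingham.r n) * FisherBingham.ι n := by 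
  refine ⟨FisherBingham.isGroebnerBasis_basis n, fun i => ?_, ?_, fun i j hij => ?_, fun k => ?_,
    ?_, fun i => ?_, ?_, fun i j hij => ?_, fun k => ?_, ?_⟩
  · exact RatWeyl.initMonomial_eq one_ne_zero (FisherBingham.A_sub_mem_below i)
  · rw [RatWeyl.initMonomial_eq one_ne_zero (FisherBingham.B_sub_mem_below n),
      FisherBingham.monomial_yExp_single]
  · rw [RatWeyl.initMonomial_eq (FisherBingham.a_ne_zero hij.ne)
      (FisherBingham.C_sub_mem_below i j), FisherBingham.monomial_yExp_add, MvPolynomial.C_1,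
      one_mul]
  · rw [RatWeyl.initMonomial_eq one_ne_zero (FisherBingham.D_sub_mem_below k),
      FisherBingham.monomial_yExp_single]
  · exact RatWeyl.initMonomial_eq (FisherBingham.var_ne_zero _) (FisherBingham.E_sub_mem_below n)
  · exact RatWeyl.initTerm_eq one_ne_zero (FisherBingham.A_sub_mem_below i)
  · rw [RatWeyl.initTerm_eq one_ne_zero (FisherBingham.B_sub_mem_below n),
      FisherBingham.monomial_yExp_single]
  · rw [RatWeyl.initTerm_eq (FisherBingham.a_ne_zero hij.ne) (FisherBingham.C_sub_mem_below i j),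
      FisherBingham.monomial_yExp_add]
  · rw [RatWeyl.initTerm_eq one_ne_zero (FisherBingham.D_sub_mem_below k),
      FisherBingham.monomial_yExp_single]
  · rw [RatWeyl.initTerm_eq (FisherBingham.var_ne_zero _) (FisherBingham.E_sub_mem_below n),
      FisherBingham.ι, MvPolynomial.X, MvPolynomial.C_mul_monomial, mul_one]
    rfl
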